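/- **Setting.** Let $\mathcal X,\mathcal Y$ be finite sets of prompts and responses, $\nu$ a distribution on $\mathcal X$, $\pi_{\mathrm{ref}}(\cdot\mid x)$ a fixed strictly positive reference policy, $r:\mathcal X\times\mathcal Y\to\mathbb R$ a reward and $\beta>0$. Write $\sigma(u)=1/(1+e^{-u})$ and $\ell_\pi(x,y)=\log\frac{\pi(y\mid x)}{\pi_{\mathrm{ref}}(y\mid x)}$. The objective is $\mathcal J(\pi)=\mathbb E_{x\sim\nu,\,y\sim\pi(\cdot\mid x)}[r(x,y)-\beta\,\ell_\pi(x,y)]$, and $\pi^*$ is a maximizer of $\mathcal J$ over all policies. $\Pi$ is a class of strictly positive policies with $\pi^*\in\Pi$ and $|\ell_\pi(x,y)|\le R_{\max}$ for all $\pi\in\Pi$ and all $(x,y)$. **Algorithm (theoretical SELM, $T\ge1$ rounds, optimism coefficient $\alpha$, finite $\Pi$).** Put $\pi_0=\pi_{\mathrm{ref}}$. In round $t=1,\dots,T$, given the past, draw $x_t\sim\nu$ and independently $y_t^1\sim\pi_{t-1}(\cdot\mid x_t)$, $y_t^2\sim\pi_{\mathrm{ref}}(\cdot\mid x_t)$.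 The pair is labelled as chosen and rejected responses $(y_{w,t},y_{l,t})$ by the Bradley–Terry model: $y_t^1$ is preferred with probability $\sigma(r(x_t,y_t^1)-r(x_t,y_t^2))$. Then $\pi_t$ is any maximizer over $\pi\in\Pi$ (ties broken arbitrarily, possibly at random) of $$-\mathcal L_{\mathrm{DPO}}(\pi;\mathcal D_t)-\alpha\,\mathbb E_{x\sim\nu,\,y\sim\pi_{\mathrm{ref}}(\cdot\mid x)}[\log\pi(y\mid x)],\qquad \mathcal L_{\mathrm{DPO}}(\pi;\mathcal D_t)=-\sum_{i=1}^t\log\sigma\bigl(\beta\,\ell_\pi(x_i,y_{w,i})-\beta\,\ell_\pi(x_i,y_{l,i})\bigr).$$ The regret is $\mathcal R(T)=\sum_{t=1}^T[\mathcal J(\pi^*)-\mathcal J(\pi_t)]$. **Complexity.** For $\pi\in\Pi$ let $e_\pi(x,y,y')=\ell_{\pi^*}(x,y)-\ell_\pi(x,y)-\ell_{\pi^*}(x,y')+\ell_\pi(x,y')$. The preference-based generalized eluder coefficient $d_{\mathrm{PGEC}}$ (for $\Pi,\pi^*,\nu,\pi_{\mathrm{ref}},T$) is the smallest $d\ge0$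 such that for every sequence $\pi_1,\dots,\pi_T\in\Pi$, $$\sum_{t=1}^T\mathbb E_{(x,y,y')\sim(\nu,\pi_{\mathrm{ref}},\pi_t)}[e_{\pi_t}(x,y,y')]\le\sqrt{d\sum_{t=1}^T\sum_{\tau=1}^{t-1}\mathbb E_{(x,y,y')\sim(\nu,\pi_{\mathrm{ref}},\pi_\tau)}[e_{\pi_t}(x,y,y')^2]}+4\sqrt{dT}.$$ **Theorem.** (1) There is an absolute constant $C$ such that the following holds. Let $\Pi$ be finite, $\delta\in(0,1)$, and let $d>0$ be $d_{\mathrm{PGEC}}$ or any larger number. Let $$\eta=\sqrt{\frac{d}{T\exp(2\beta R_{\max})\log(|\Pi|/\delta)}},\qquad \alpha=\frac{2\beta}{\eta\exp(2\beta R_{\max})}.$$ Then with probability at least $1-\delta$, $$\mathcal R(T)\le C\max(1,\beta)\sqrt{d\cdot\exp(2\beta R_{\max})\cdot T\cdot\log(|\Pi|/\delta)} .$$ In particular, for $\beta\le 1$ the bound is at most $C\sqrt{d\,\exp(2R_{\max})\,T\log(|\Pi|/\delta)}$. (2) There is an absolute constant $C$ such that if $\Pi=\{\pi_\theta:\theta\in\Theta\}$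 with $\Theta\subseteq\mathbb R^k$, $\phi:\mathcal X\times\mathcal Y\to\mathbb R^k$ and $\pi_\theta(y\mid x)\propto\exp(\langle\phi(x,y),\theta\rangle/\beta)$ (and $\Pi$ is as in the setting, possibly infinite), then the smallest $d$ above is attained and, with $\iota=\log(2+kTR_{\max}^2)$, $$d_{\mathrm{PGEC}}\le C\,k\,\iota\,\Bigl(1+R_{\max}^2\min\bigl\{1,\tfrac{k\iota}{T}\bigr\}\Bigr).$$ That is, $d_{\mathrm{PGEC}}=\tilde O(k)$: at most $C(1+R_{\max}^2)k\iota$ for all $T$, and at most $2Ck\iota$ once $T\ge R_{\max}^2k\iota$. -/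

import Mathlib

open MeasureTheory

namespace SELM

/-- A policy: for every prompt `x`, a probability vector `π x` over responses. -/
abbrev Policy (X Y : Type*) [Fintype Y] := X → stdSimplex ℝ Y

/-- The probability `π(y ∣ x)`. -/
def Policy.prob {X Y : Type*} [Fintype Y] (π : Policy X Y) (x : X) (y : Y) : ℝ :=
  (π x : Y → ℝ) y

/-- The data of the alignment problem: prompt distribution `ν`, reference policy `π_ref`,
reward `r` and regularization coefficient `β > 0`. -/
structure Problem (X Y : Type*) [Fintype X] [Fintype Y] where
  ν : stdSimplex ℝ X
  ref : Policy X Y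
  r : X → Y → ℝ
  β : ℝ
  β_pos : 0 < β

/-- One collected comparison: a prompt, two responses, and the label
(`true` when the first response is preferred over the second). -/
structure Comparison (X Y : Type*) where
  x : X
  y₁ : Y
  y₂ : Y
  label : Bool

namespace Comparison

variable {X Y : Type*}

/-- The chosen response. -/
def chosen (s : Comparison X Y) : Y := if s.label then s.y₁ else s.y₂

/-- The rejected response. -/
def rejected (s : Comparison X Y) : Y := if s.label then s.y₂ else s.y₁

end Comparison

namespace Problem

variable {X Y : Type*} [Fintype X] [Fintype Y] (P : Problem X Y)

/-- `𝔼_{x ∼ ν} [f x]`. -/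
noncomputable def promptMean (f : X → ℝ) : ℝ := ∑ x, (P.ν : X → ℝ) x * f x

/-- `log (π(y ∣ x) / π_ref(y ∣ x))`. -/
noncomputable def logRatio (π : Policy X Y) (x : X) (y : Y) : ℝ :=
  Real.log (π.prob x y / P.ref.prob x y)

/-- `𝒥(π) = 𝔼_{x ∼ ν, y ∼ π} [r(x, y) - β log (π(y ∣ x) / π_ref(y ∣ x))]`. -/
noncomputable def value (π : Policy X Y) : ℝ :=
  P.promptMean fun x => ∑ y, π.prob x y * (P.r x y - P.β * P.logRatio π x y)

/-- `π` maximizes the regularized objective among all policies. -/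
def IsOptimal (π : Policy X Y) : Prop := ∀ π' : Policy X Y, P.value π' ≤ P.value π

/-- Realizable policy class with bounded log-ratios. The reference policy and the members of the
class are strictly positive, so that every log-ratio below is a genuine finite logarithm. -/
structure IsRegularClass (𝒞 : Set (Policy X Y)) (πstar : Policy X Y) (R : ℝ) : Prop where
  optimal : P.IsOptimal πstar
  realizable : πstar ∈ 𝒞
  ref_pos : ∀ x y, 0 < P.ref.prob x y
  pos : ∀ π ∈ 𝒞, ∀ x y, 0 < π.prob x y
  bounded : ∀ π ∈ 𝒞, ∀ x y, |P.logRatio π x y| ≤ R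

/-- Bradley-Terry probability that `y` is preferred over `y'` given `x`. -/
noncomputable def prefProb (x : X) (y y' : Y) : ℝ := Real.sigmoid (P.r x y - P.r x y')

/-- The probability of the comparison `s` when `x ∼ ν`, `y₁ ∼ π(· ∣ x)`, `y₂ ∼ π_ref(· ∣ x)`
independently given `x`, and the label follows the Bradley-Terry model. -/
noncomputable def comparisonProb (π : Policy X Y) (s : Comparison X Y) : ℝ :=
  (P.ν : X → ℝ) s.x * π.prob s.x s.y₁ * P.ref.prob s.x s.y₂ *
    P.prefProb s.x s.chosen s.rejected

/-- The DPO loss of `π` (the negative log-likelihood) on the comparisons `s 1, …, s t`. -/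
noncomputable def dpoLoss (s : ℕ → Comparison X Y) (t : ℕ) (π : Policy X Y) : ℝ :=
  -∑ i ∈ Finset.Icc 1 t, Real.log (Real.sigmoid
    (P.β * P.logRatio π (s i).x (s i).chosen - P.β * P.logRatio π (s i).x (s i).rejected))

/-- The training objective
`-L_DPO(π; D_t) - α 𝔼_{x ∼ ν, y ∼ π_ref} [log π(y ∣ x)]`. -/
noncomputable def objective (α : ℝ) (s : ℕ → Comparison X Y) (t : ℕ) (π : Policy X Y) : ℝ :=
  -P.dpoLoss s t π -
    α * P.promptMean fun x => ∑ y, P.ref.prob x y * Real.log (π.prob x y)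

/-- A run of `T` rounds of the self-exploring algorithm over the policy class `𝒞` with optimism
coefficient `α`, on a probability space `(Ω, μ)` with filtration `ℱ`. `S t` is the comparison
collected in round `t`, and `π t` is the policy trained at the end of round `t`; `π 0` is the
reference policy. Ties in the maximization may be broken in any way, also at random. -/
structure IsRun {Ω : Type*} {mΩ : MeasurableSpace Ω} (μ : Measure Ω) (ℱ : Filtration ℕ mΩ)
    (𝒞 : Set (Policy X Y)) (α : ℝ) (T : ℕ) (S : ℕ → Ω → Comparison X Y)
    (π : ℕ → Ω → Policy X Y) : Prop where
  init : ∀ ω, π 0 ω = P.ref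
  measurable_sample : ∀ t ∈ Finset.Icc 1 T, ∀ s, MeasurableSet[ℱ t] {ω | S t ω = s}
  measurable_policy : ∀ t ≤ T, ∀ x y, Measurable[ℱ t] fun ω => (π t ω).prob x y
  /-- given the past, the comparison of round `t + 1` is drawn using `π t` and `π_ref` -/
  sampling : ∀ t < T, ∀ s,
    μ[({ω | S (t + 1) ω = s}).indicator (fun _ => (1 : ℝ)) | ℱ t]
      =ᵐ[μ] fun ω => P.comparisonProb (π t ω) s
  mem_class : ∀ t ∈ Finset.Icc 1 T, ∀ ω, π t ω ∈ 𝒞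
  argmax : ∀ t ∈ Finset.Icc 1 T, ∀ ω, ∀ π' ∈ 𝒞,
    P.objective α (fun i => S i ω) t π' ≤ P.objective α (fun i => S i ω) t (π t ω)

/-- Cumulative regret of the policies `π 1, …, π T`. -/
noncomputable def regret (πstar : Policy X Y) (π : ℕ → Policy X Y) (T : ℕ) : ℝ :=
  ∑ t ∈ Finset.Icc 1 T, (P.value πstar - P.value (π t))

/-- The error of the pairwise log-ratio difference of `π` at `(x, y, y')`. -/
noncomputable def pairError (πstar π : Policy X Y) (x : X) (y y' : Y) : ℝ :=
  P.logRatio πstar x y - P.logRatio π x y - P.logRatio πstar x y' + P.logRatio π x y'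

/-- `𝔼_{(x, y, y') ∼ (ν, π_ref, ρ)} [f x y y']`. -/
noncomputable def pairMean (ρ : Policy X Y) (f : X → Y → Y → ℝ) : ℝ :=
  P.promptMean fun x => ∑ y, ∑ y', P.ref.prob x y * ρ.prob x y' * f x y y'

/-- `d` satisfies the inequality that defines the preference-based generalized eluder coefficient
at horizon `T`, for every sequence of policies of the class. -/
def IsPGECBound (𝒞 : Set (Policy X Y)) (πstar : Policy X Y) (T : ℕ) (d : ℝ) : Prop :=
  ∀ π : ℕ → Policy X Y, (∀ t, π t ∈ 𝒞) →
    ∑ t ∈ Finset.Icc 1 T, P.pairMean (π t) (P.pairError πstar (π t)) ≤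
      √(d * ∑ t ∈ Finset.Icc 1 T, ∑ τ ∈ Finset.Ico 1 t,
          P.pairMean (π τ) (fun x y y' => P.pairError πstar (π t) x y y' ^ 2)) +
        4 * √(d * T)

/-- The preference-based generalized eluder coefficient `d_PGEC` at horizon `T`: the smallest
`d ≥ 0` satisfying the defining inequality. -/
noncomputable def pgec (𝒞 : Set (Policy X Y)) (πstar : Policy X Y) (T : ℕ) : ℝ :=
  sInf {d : ℝ | 0 ≤ d ∧ P.IsPGECBound 𝒞 πstar T d}

end Problem

/-- The log-linear class `{π_θ : θ ∈ Θ}`, `π_θ(y ∣ x) ∝ exp (⟪φ(x, y), θ⟫ / β)`. -/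
def logLinearClass {X Y : Type*} [Fintype Y] {k : ℕ} (φ : X → Y → EuclideanSpace ℝ (Fin k))
    (β : ℝ) (Θ : Set (EuclideanSpace ℝ (Fin k))) : Set (Policy X Y) :=
  {π | ∃ θ ∈ Θ, ∀ x y, π.prob x y =
    Real.exp (inner ℝ (φ x y) θ / β) / ∑ y', Real.exp (inner ℝ (φ x y') θ / β)}

end SELM

/-! Regret. Optimality forces π* to be the Gibbs policy, so on the support of ν the reward is β
times the log-ratio of π* plus a function of the prompt. Hence a value gap is β times the mean
pairwise error plus β times the gap in reference log-likelihood between π_t and π* (`value_sub_eq`).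
The optimism term controls exactly the second gap: comparing π_t with π* in the argmax bounds α
times it by the log-likelihood ratio of π_t to π* on the data. Exponentiating half a log-likelihood
ratio gives Hellinger affinities, whose conditional means decay with the squared pairwise error
under the sampling policy (`sum_comparisonProb_le`). Ville's inequality and a union bound over the
class then bound the ratio, at all rounds at once, by 2 log(|Π|/δ) minus a multiple of the past
squared errors. The eluder coefficient bounds the current errors by the root of the same sum of
squares, and AM-GM with the chosen η cancels the two (`regret_le`).

Log-linear classes. The pairwise error is linear in the parameter, so the means of the error of π_t
under π_τ form a matrix of rank at most k. Nothing bounds φ or Θ themselves, only the errors, by 4R.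
A barycentric spanner of the parameter differences supplies coordinates in [-1, 1] and features
bounded by 4R, so the log-determinant potential depends on k, T and R alone. Rounds of large
potential number O(kι) and cost at most 4R each, which produces the correction in R². -/

/-! ### Positive definite matrices and the elliptical potential -/

open Matrix in
/-- Cauchy-Schwarz in the geometry of a positive definite matrix and its inverse. -/
theorem Matrix.PosDef.sq_dotProduct_le {m : Type*} [Fintype m] [DecidableEq m]
    {V : Matrix m m ℝ} (hV : V.PosDef) (v c : m → ℝ) :
    (v ⬝ᵥ c) ^ 2 ≤ (v ⬝ᵥ V⁻¹ *ᵥ v) * (c ⬝ᵥ V *ᵥ c) := by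
  have hdet : IsUnit V.det := (Matrix.isUnit_iff_isUnit_det _).1 hV.isUnit
  have hVs : Vᵀ = V := by simpa using hV.isHermitian.eq
  by_cases hv : v = 0
  · simp [hv]
  set u := V⁻¹ *ᵥ v with hu
  have hVu : V *ᵥ u = v := by
    rw [hu, Matrix.mulVec_mulVec, Matrix.mul_nonsing_inv _ hdet, Matrix.one_mulVec]
  have hpos : 0 < v ⬝ᵥ u := by simpa using hV.inv.dotProduct_mulVec_pos hv
  have huVc : u ⬝ᵥ V *ᵥ c = v ⬝ᵥ c := by
    rw [Matrix.dotProduct_mulVec, ← Matrix.mulVec_transpose, hVs, hVu]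
  -- The minimizer over s of the quadratic form of V at c + s u.
  set s : ℝ := -(v ⬝ᵥ c) / (v ⬝ᵥ u) with hs
  have key : 0 ≤ (c + s • u) ⬝ᵥ V *ᵥ (c + s • u) := by
    simpa using hV.posSemidef.dotProduct_mulVec_nonneg (c + s • u)
  have hexp : (c + s • u) ⬝ᵥ V *ᵥ (c + s • u)
      = c ⬝ᵥ V *ᵥ c + 2 * s * (v ⬝ᵥ c) + s ^ 2 * (v ⬝ᵥ u) := by
    rw [Matrix.mulVec_add, Matrix.mulVec_smul, hVu]
    simp only [add_dotProduct, dotProduct_add, smul_dotProduct, dotProduct_smul, smul_eq_mul, huVc]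
    rw [dotProduct_comm c v, dotProduct_comm u v]
    ring
  rw [hexp] at key
  have : s * (v ⬝ᵥ u) = -(v ⬝ᵥ c) := by rw [hs]; field_simp
  have h2 : 0 ≤ (v ⬝ᵥ u) * (c ⬝ᵥ V *ᵥ c + 2 * s * (v ⬝ᵥ c) + s ^ 2 * (v ⬝ᵥ u)) :=
    mul_nonneg hpos.le key
  have h3 : (v ⬝ᵥ u) * (c ⬝ᵥ V *ᵥ c + 2 * s * (v ⬝ᵥ c) + s ^ 2 * (v ⬝ᵥ u))
      = (v ⬝ᵥ u) * (c ⬝ᵥ V *ᵥ c) + 2 * (s * (v ⬝ᵥ u)) * (v ⬝ᵥ c) + (s * (v ⬝ᵥ u)) ^ 2 := by ring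
  rw [h3, this] at h2
  nlinarith

open Matrix in
/-- The rank-one case of the matrix determinant lemma. -/
theorem Matrix.PosDef.det_add_vecMulVec_self {m : Type*} [Fintype m] [DecidableEq m]
    {V : Matrix m m ℝ} (hV : V.PosDef) (v : m → ℝ) :
    (V + vecMulVec v v).det = V.det * (1 + v ⬝ᵥ V⁻¹ *ᵥ v) := by
  have hdet : IsUnit V.det := (Matrix.isUnit_iff_isUnit_det _).1 hV.isUnit
  have h := Matrix.det_add_replicateCol_mul_replicateRow (ι := Unit) hdet v v
  rw [← Matrix.vecMulVec_eq] at h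
  rw [h]
  congr 1
  rw [Matrix.det_unique]
  simp [Matrix.mul_apply, dotProduct, Matrix.mulVec, Finset.sum_mul, Finset.mul_sum]
  rw [Finset.sum_comm]
  simp only [mul_assoc]

/-- The log-determinant is at most what the trace allows. -/
theorem Matrix.PosDef.log_det_le {m : Type*} [Fintype m] [DecidableEq m]
    {V : Matrix m m ℝ} (hV : V.PosDef) {c : ℝ} (hc : 0 < c)
    (htr : V.trace ≤ Fintype.card m * c) :
    Real.log V.det ≤ Fintype.card m * Real.log c := by
  have hpos := hV.eigenvalues_pos
  rw [hV.isHermitian.det_eq_prod_eigenvalues]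
  rw [hV.isHermitian.trace_eq_sum_eigenvalues] at htr
  simp only [RCLike.ofReal_real_eq_id, id_eq] at htr ⊢
  rw [Real.log_prod (fun i _ => (hpos i).ne')]
  -- Tangent line of the logarithm at c; summed over eigenvalues, it only sees the trace.
  have h1 : ∀ i, Real.log (hV.isHermitian.eigenvalues i)
      ≤ hV.isHermitian.eigenvalues i / c - 1 + Real.log c := by
    intro i
    have := Real.log_le_sub_one_of_pos (div_pos (hpos i) hc)
    rw [Real.log_div (hpos i).ne' hc.ne'] at this
    linarith
  calc _ ≤ ∑ i, (hV.isHermitian.eigenvalues i / c - 1 + Real.log c) :=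
        Finset.sum_le_sum fun i _ => h1 i
    _ = (∑ i, hV.isHermitian.eigenvalues i) / c - Fintype.card m + Fintype.card m * Real.log c := by
        simp [Finset.sum_add_distrib, Finset.sum_sub_distrib, Finset.sum_div]
    _ ≤ _ := by
        have : (∑ i, hV.isHermitian.eigenvalues i) / c ≤ Fintype.card m := by
          rwa [div_le_iff₀ hc]
        linarith

open Matrix in
/-- Elliptical potential bound for predictions `⟪v t, c t⟫` with bounded coordinates. -/
theorem exists_elliptical_potential {m k : ℕ} (hmk : m ≤ k) (hk : 1 ≤ k) {L : ℝ}
    (v c : ℕ → Fin m → ℝ) (hv : ∀ t i, |v t i| ≤ L) (hc : ∀ t i, |c t i| ≤ 1) (T : ℕ) :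
    ∃ g : ℕ → ℝ, (∀ t, 0 ≤ g t) ∧
      (∀ t, (v t ⬝ᵥ c t) ^ 2 ≤ g t * (1 + ∑ τ ∈ Finset.Ico 1 t, (v τ ⬝ᵥ c t) ^ 2)) ∧
      ∑ t ∈ Finset.Icc 1 T, Real.log (1 + g t) ≤ k * Real.log (1 + k * T * L ^ 2) := by
  have hk0 : (0 : ℝ) < k := by exact_mod_cast hk
  -- With ridge 1/k, a vector of at most k coordinates in [-1, 1] has ridge energy at most 1, the
  -- constant in the claim.
  set V : ℕ → Matrix (Fin m) (Fin m) ℝ := fun t =>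
    (k : ℝ)⁻¹ • (1 : Matrix (Fin m) (Fin m) ℝ) + ∑ τ ∈ Finset.Ico 1 t, vecMulVec (v τ) (v τ) with hVdef
  have hV : ∀ t, (V t).PosDef := by
    intro t
    refine Matrix.PosDef.add_posSemidef (Matrix.PosDef.one.smul (inv_pos.2 hk0)) ?_
    refine Matrix.posSemidef_sum _ fun τ _ => ?_
    simpa using Matrix.posSemidef_vecMulVec_self_star (v τ)
  have hquad : ∀ t, c t ⬝ᵥ V t *ᵥ c t ≤ 1 + ∑ τ ∈ Finset.Ico 1 t, (v τ ⬝ᵥ c t) ^ 2 := by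
    intro t
    have h1 : c t ⬝ᵥ V t *ᵥ c t
        = (k : ℝ)⁻¹ * (c t ⬝ᵥ c t) + ∑ τ ∈ Finset.Ico 1 t, (v τ ⬝ᵥ c t) ^ 2 := by
      simp only [hVdef, Matrix.add_mulVec, dotProduct_add, Matrix.smul_mulVec, Matrix.one_mulVec,
        dotProduct_smul, smul_eq_mul, Matrix.sum_mulVec, dotProduct_sum]
      congr 1
      refine Finset.sum_congr rfl fun τ _ => ?_
      rw [Matrix.vecMulVec_mulVec]
      simp [dotProduct_comm (c t) (v τ), sq]
    have h2 : c t ⬝ᵥ c t ≤ k := by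
      calc c t ⬝ᵥ c t ≤ ∑ _i : Fin m, (1 : ℝ) := Finset.sum_le_sum fun i _ => by
            have := hc t i
            rw [← sq, ← sq_abs]
            exact pow_le_one₀ (abs_nonneg _) this
        _ ≤ k := by simpa using hmk
    rw [h1]
    have : (k : ℝ)⁻¹ * (c t ⬝ᵥ c t) ≤ 1 := by
      rw [inv_mul_le_iff₀ hk0]; linarith
    linarith
  have hg : ∀ t, 0 ≤ v t ⬝ᵥ (V t)⁻¹ *ᵥ v t := fun t => by
    simpa using (hV t).inv.posSemidef.dotProduct_mulVec_nonneg (v t)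
  refine ⟨fun t => v t ⬝ᵥ (V t)⁻¹ *ᵥ v t, hg, fun t => ?_, ?_⟩
  · exact ((hV t).sq_dotProduct_le _ _).trans (mul_le_mul_of_nonneg_left (hquad t) (hg t))
  have hstep : ∀ t, 1 ≤ t → V (t + 1) = V t + vecMulVec (v t) (v t) := by
    intro t ht
    simp only [hVdef]
    rw [Finset.sum_Ico_succ_top ht, add_assoc]
  -- Each rank-one update multiplies the determinant by 1 + g t, so the sum telescopes.
  have hsum : ∑ t ∈ Finset.Icc 1 T, Real.log (1 + v t ⬝ᵥ (V t)⁻¹ *ᵥ v t)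
      = Real.log (V (T + 1)).det - Real.log (V 1).det := by
    induction T with
    | zero => simp
    | succ n ih =>
      rw [Finset.sum_Icc_succ_top (by omega), ih, hstep (n + 1) (by omega),
        (hV (n + 1)).det_add_vecMulVec_self,
        Real.log_mul (hV _).det_pos.ne' (by linarith [hg (n + 1)])]
      ring
  rw [hsum]
  have hV1 : Real.log (V 1).det = m * Real.log (k : ℝ)⁻¹ := by
    simp [hVdef]
  have hc0 : 0 < (k : ℝ)⁻¹ + T * L ^ 2 := by positivity
  have hVT : Real.log (V (T + 1)).det ≤ m * Real.log ((k : ℝ)⁻¹ + T * L ^ 2) := by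
    have := (hV (T + 1)).log_det_le hc0 ?_
    · simpa using this
    simp only [hVdef, Matrix.trace_add, Matrix.trace_smul, Matrix.trace_one, Matrix.trace_sum,
      Matrix.trace_vecMulVec, Fintype.card_fin, smul_eq_mul]
    have : ∑ τ ∈ Finset.Ico 1 (T + 1), v τ ⬝ᵥ v τ ≤ T * (m * L ^ 2) := by
      calc _ ≤ ∑ τ ∈ Finset.Ico 1 (T + 1), (m * L ^ 2 : ℝ) := Finset.sum_le_sum fun τ _ => by
            calc v τ ⬝ᵥ v τ ≤ ∑ _i : Fin m, L ^ 2 := Finset.sum_le_sum fun i _ => by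
                  rw [← sq, ← sq_abs]
                  exact pow_le_pow_left₀ (abs_nonneg _) (hv τ i) 2
              _ = m * L ^ 2 := by simp
        _ = _ := by simp
    nlinarith
  have hlog : Real.log ((k : ℝ)⁻¹ + T * L ^ 2) - Real.log (k : ℝ)⁻¹
      = Real.log (1 + k * T * L ^ 2) := by
    rw [← Real.log_div hc0.ne' (by positivity)]
    congr 1
    field_simp
  have hnn : 0 ≤ Real.log (1 + k * T * L ^ 2) := Real.log_nonneg (by
    have : (0 : ℝ) ≤ k * T * L ^ 2 := by positivity
    linarith)
  have hmk' : (m : ℝ) ≤ k := by exact_mod_cast hmk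
  calc _ ≤ m * (Real.log ((k : ℝ)⁻¹ + T * L ^ 2) - Real.log (k : ℝ)⁻¹) := by
        rw [hV1]; linarith
    _ = m * Real.log (1 + k * T * L ^ 2) := by rw [hlog]
    _ ≤ _ := mul_le_mul_of_nonneg_right hmk' hnn

/-! ### Barycentric spanners -/

/-- A finite family of vectors has a barycentric spanner: a subfamily, of size at most the
dimension, of which every member is a combination with coefficients in `[-1, 1]`. -/
theorem exists_barycentric_spanner {E ι : Type*} [AddCommGroup E] [Module ℝ E]
    [FiniteDimensional ℝ E] [Finite ι] (w : ι → E) :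
    ∃ m ≤ Module.finrank ℝ E, ∃ u : Fin m → ι,
      ∀ t, ∃ c : Fin m → ℝ, (∀ i, |c i| ≤ 1) ∧ w t = ∑ i, c i • w (u i) := by
  classical
  set W := Submodule.span ℝ (Set.range w) with hW
  set m := Module.finrank ℝ W with hm
  let w' : ι → W := fun t => ⟨w t, Submodule.subset_span ⟨t, rfl⟩⟩
  let b : Module.Basis (Fin m) ℝ W := Module.finBasis ℝ W
  obtain ⟨f, hf, -, hfi⟩ := Submodule.exists_fun_fin_finrank_span_eq ℝ (Set.range w)
  choose u₀ hu₀ using hf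
  have : Nonempty (Fin m → ι) := ⟨u₀⟩
  have hli₀ : LinearIndependent ℝ (w' ∘ u₀) := by
    have : LinearIndependent ℝ (W.subtype ∘ (w' ∘ u₀)) := by
      rw [show W.subtype ∘ (w' ∘ u₀) = f from funext hu₀]
      exact hfi
    exact this.of_comp
  -- The spanner is a subfamily of largest volume within the span; it is a basis since some
  -- subfamily has nonzero volume.
  obtain ⟨u, hu⟩ := Finite.exists_max fun u : Fin m → ι => |b.det (w' ∘ u)|
  have hcard : Fintype.card (Fin m) = Module.finrank ℝ W := by simp [hm]
  have h0 : b.det (w' ∘ u₀) ≠ 0 := by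
    have := (b.is_basis_iff_det (v := w' ∘ u₀)).1
      ⟨hli₀, hli₀.span_eq_top_of_card_eq_finrank' hcard⟩
    exact this.ne_zero
  have hu0 : b.det (w' ∘ u) ≠ 0 := by
    intro h
    have := hu u₀
    simp only [h, abs_zero] at this
    exact h0 (abs_eq_zero.1 (le_antisymm this (abs_nonneg _)))
  obtain ⟨hli, hsp⟩ := (b.is_basis_iff_det (v := w' ∘ u)).2 (isUnit_iff_ne_zero.2 hu0)
  let e : Module.Basis (Fin m) ℝ W := Module.Basis.mk hli hsp.ge
  refine ⟨m, Submodule.finrank_le W, u, fun t => ⟨fun i => e.repr (w' t) i, fun i => ?_, ?_⟩⟩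
  · have hrep : w' t = ∑ j, e.repr (w' t) j • (w' ∘ u) j := by
      conv_lhs => rw [← e.sum_repr (w' t)]
      simp [e]
    -- Cramer's rule: the i-th coordinate is the ratio of volumes after exchanging one vector, so
    -- maximality bounds it by 1.
    have hup : b.det (w' ∘ Function.update u i t) = e.repr (w' t) i * b.det (w' ∘ u) := by
      have h1 : w' ∘ Function.update u i t = Function.update (w' ∘ u) i (w' t) := by
        rw [Function.comp_update]
      rw [h1, hrep, AlternatingMap.map_update_sum]
      rw [Finset.sum_eq_single i]
      · rw [AlternatingMap.map_update_smul, Function.update_eq_self, ← hrep, smul_eq_mul]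
      · intro j _ hj
        rw [AlternatingMap.map_update_smul, AlternatingMap.map_update_self _ _ (Ne.symm hj),
          smul_zero]
      · simp
    have := hu (Function.update u i t)
    simp only [hup, abs_mul] at this
    exact le_of_mul_le_mul_right (by simpa using this) (abs_pos.2 hu0)
  · have := congrArg W.subtype (e.sum_repr (w' t))
    rw [map_sum] at this
    simpa [e, w'] using this.symm

/-! ### From potentials to sums -/

/-- Sum bound from an elliptical potential: the rounds with a large potential are few and are
bounded individually. -/
theorem sum_le_of_elliptical_potential {T : ℕ} {a b g : ℕ → ℝ} {D M : ℝ} (hM : 0 ≤ M)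
    (ha : ∀ t, a t ≤ M) (hb : ∀ t, 0 ≤ b t) (hg : ∀ t, 0 ≤ g t)
    (hag : ∀ t ∈ Finset.Icc 1 T, a t ^ 2 ≤ g t * (1 + b t))
    (hD : ∑ t ∈ Finset.Icc 1 T, Real.log (1 + g t) ≤ D / 2) :
    ∑ t ∈ Finset.Icc 1 T, a t ≤
      √(D * ∑ t ∈ Finset.Icc 1 T, b t) + √(D * T) + M * min D T := by
  -- Via log(1 + g) ≥ g / (1 + g) ≥ min(1, g) / 2.
  have hmin : ∀ t, min 1 (g t) ≤ 2 * Real.log (1 + g t) := by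
    intro t
    have h0 := hg t
    have h1 := Real.one_sub_inv_le_log_of_pos (show 0 < 1 + g t by linarith)
    have h2 : 1 - (1 + g t)⁻¹ = g t / (1 + g t) := by field_simp; ring
    rw [h2] at h1
    have h3 : min 1 (g t) ≤ 2 * (g t / (1 + g t)) := by
      rw [← mul_div_assoc, le_div_iff₀ (by linarith)]
      rcases le_total 1 (g t) with h | h
      · rw [min_eq_left h]; linarith
      · rw [min_eq_right h]; nlinarith
    linarith
  have hmin0 : ∀ t, 0 ≤ min 1 (g t) := fun t => le_min zero_le_one (hg t)
  have hG : ∑ t ∈ Finset.Icc 1 T, min 1 (g t) ≤ D := by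
    calc _ ≤ ∑ t ∈ Finset.Icc 1 T, 2 * Real.log (1 + g t) :=
          Finset.sum_le_sum fun t _ => hmin t
      _ ≤ D := by rw [← Finset.mul_sum]; linarith
  have hGT : ∑ t ∈ Finset.Icc 1 T, (if 1 < g t then (1 : ℝ) else 0) ≤ min D T := by
    refine le_min (le_trans (Finset.sum_le_sum fun t _ => ?_) hG) ?_
    · split_ifs with h
      · exact le_min le_rfl h.le
      · exact hmin0 t
    · calc _ ≤ ∑ _t ∈ Finset.Icc 1 T, (1 : ℝ) := Finset.sum_le_sum fun t _ => by
            split_ifs <;> norm_num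
        _ = T := by simp
  -- Rounds with g > 1 pay the uniform bound M; in the others min 1 g is g, ready for
  -- Cauchy-Schwarz.
  have hpt : ∀ t ∈ Finset.Icc 1 T,
      a t ≤ √(min 1 (g t)) * √(1 + b t) + M * (if 1 < g t then (1 : ℝ) else 0) := by
    intro t ht
    by_cases h : 1 < g t
    · rw [if_pos h]
      have : 0 ≤ √(min 1 (g t)) * √(1 + b t) := by positivity
      linarith [ha t]
    · rw [if_neg h, min_eq_right (not_lt.1 h), ← Real.sqrt_mul (hg t)]
      have := Real.le_sqrt_of_sq_le (hag t ht)
      linarith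
  have hCS := Real.sum_sqrt_mul_sqrt_le (Finset.Icc 1 T) (f := fun t => min 1 (g t))
    (g := fun t => 1 + b t) hmin0 (fun t => by linarith [hb t])
  have hB : 0 ≤ ∑ t ∈ Finset.Icc 1 T, b t := Finset.sum_nonneg fun t _ => hb t
  have hD0 : 0 ≤ D := le_trans (Finset.sum_nonneg fun t _ => hmin0 t) hG
  have h1b : ∑ t ∈ Finset.Icc 1 T, (1 + b t) = T + ∑ t ∈ Finset.Icc 1 T, b t := by
    simp [Finset.sum_add_distrib]
  calc _ ≤ ∑ t ∈ Finset.Icc 1 T,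
        (√(min 1 (g t)) * √(1 + b t) + M * (if 1 < g t then (1 : ℝ) else 0)) :=
        Finset.sum_le_sum hpt
    _ = ∑ t ∈ Finset.Icc 1 T, √(min 1 (g t)) * √(1 + b t)
        + M * ∑ t ∈ Finset.Icc 1 T, (if 1 < g t then (1 : ℝ) else 0) := by
        rw [Finset.sum_add_distrib, Finset.mul_sum]
    _ ≤ √D * √(T + ∑ t ∈ Finset.Icc 1 T, b t) + M * min D T := by
        gcongr
        refine hCS.trans ?_
        rw [h1b]
        gcongr
    _ ≤ √D * (√T + √(∑ t ∈ Finset.Icc 1 T, b t)) + M * min D T := by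
        gcongr
        rw [Real.sqrt_le_left (by positivity), add_sq, Real.sq_sqrt hB,
          Real.sq_sqrt (Nat.cast_nonneg T)]
        have : 0 ≤ 2 * √(T : ℝ) * √(∑ t ∈ Finset.Icc 1 T, b t) := by positivity
        linarith
    _ = _ := by
        rw [Real.sqrt_mul hD0, Real.sqrt_mul hD0]; ring

/-! ### Policies and expectations -/

namespace SELM

section Policy

variable {X Y : Type*} [Fintype Y]

theorem Policy.prob_nonneg (π : Policy X Y) (x : X) (y : Y) : 0 ≤ π.prob x y := (π x).2.1 y

theorem Policy.sum_prob (π : Policy X Y) (x : X) : ∑ y, π.prob x y = 1 := (π x).2.2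

theorem Policy.nonempty_responses (π : Policy X Y) (x : X) : Nonempty Y := by
  by_contra h
  rw [not_nonempty_iff] at h
  have := π.sum_prob x
  simp at this

end Policy

variable {X Y : Type*} [Fintype X] [Fintype Y]

namespace Problem

variable (P : Problem X Y)

theorem ν_nonneg (x : X) : 0 ≤ (P.ν : X → ℝ) x := P.ν.2.1 x

theorem sum_ν : ∑ x, (P.ν : X → ℝ) x = 1 := P.ν.2.2

theorem nonempty_prompts (P : Problem X Y) : Nonempty X := by
  by_contra h
  rw [not_nonempty_iff] at h
  have := P.sum_ν
  simp at this

theorem promptMean_add (f g : X → ℝ) :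
    P.promptMean (fun x => f x + g x) = P.promptMean f + P.promptMean g := by
  simp [promptMean, mul_add, Finset.sum_add_distrib]

theorem promptMean_const_mul (c : ℝ) (f : X → ℝ) :
    P.promptMean (fun x => c * f x) = c * P.promptMean f := by
  simp only [promptMean, Finset.mul_sum]
  exact Finset.sum_congr rfl fun x _ => by ring

theorem promptMean_sub (f g : X → ℝ) :
    P.promptMean (fun x => f x - g x) = P.promptMean f - P.promptMean g := by
  simp [promptMean, mul_sub, Finset.sum_sub_distrib]

theorem promptMean_mono {f g : X → ℝ} (h : ∀ x, f x ≤ g x) :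
    P.promptMean f ≤ P.promptMean g :=
  Finset.sum_le_sum fun x _ => mul_le_mul_of_nonneg_left (h x) (P.ν_nonneg x)

/-- Needed because optimality says nothing about the reward at prompts of mass zero. -/
theorem promptMean_congr {f g : X → ℝ} (h : ∀ x, 0 < (P.ν : X → ℝ) x → f x = g x) :
    P.promptMean f = P.promptMean g := by
  refine Finset.sum_congr rfl fun x _ => ?_
  rcases (P.ν_nonneg x).eq_or_lt with h0 | h0
  · simp [← h0]
  · rw [h x h0]

theorem promptMean_const (c : ℝ) : P.promptMean (fun _ => c) = c := by
  simp [promptMean, ← Finset.sum_mul, P.sum_ν]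

theorem pairMean_add (ρ : Policy X Y) (f g : X → Y → Y → ℝ) :
    P.pairMean ρ (fun x y y' => f x y y' + g x y y') = P.pairMean ρ f + P.pairMean ρ g := by
  simp only [pairMean, ← promptMean_add, mul_add, Finset.sum_add_distrib]

theorem pairMean_const_mul (ρ : Policy X Y) (c : ℝ) (f : X → Y → Y → ℝ) :
    P.pairMean ρ (fun x y y' => c * f x y y') = c * P.pairMean ρ f := by
  simp only [pairMean, ← promptMean_const_mul, Finset.mul_sum]
  congr 1; funext x
  refine Finset.sum_congr rfl fun y _ => Finset.sum_congr rfl fun y' _ => by ring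

theorem pairMean_sum {ι : Type*} (s : Finset ι) (ρ : Policy X Y) (f : ι → X → Y → Y → ℝ) :
    P.pairMean ρ (fun x y y' => ∑ i ∈ s, f i x y y') = ∑ i ∈ s, P.pairMean ρ (f i) := by
  classical
  induction s using Finset.induction_on with
  | empty => simp [pairMean, promptMean]
  | insert i s hi ih =>
    simp only [Finset.sum_insert hi]
    rw [pairMean_add, ih]

theorem pairMean_mono (ρ : Policy X Y) {f g : X → Y → Y → ℝ} (h : ∀ x y y', f x y y' ≤ g x y y') :
    P.pairMean ρ f ≤ P.pairMean ρ g :=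
  P.promptMean_mono fun x => Finset.sum_le_sum fun y _ => Finset.sum_le_sum fun y' _ =>
    mul_le_mul_of_nonneg_left (h x y y') (mul_nonneg (P.ref.prob_nonneg x y) (ρ.prob_nonneg x y'))

theorem pairMean_left (ρ : Policy X Y) (f : X → Y → ℝ) :
    P.pairMean ρ (fun x y _ => f x y) = P.promptMean fun x => ∑ y, P.ref.prob x y * f x y := by
  unfold pairMean
  congr 1; funext x
  refine Finset.sum_congr rfl fun y _ => ?_
  rw [← Finset.sum_mul, ← Finset.mul_sum, ρ.sum_prob, mul_one]

theorem pairMean_right (ρ : Policy X Y) (f : X → Y → ℝ) :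
    P.pairMean ρ (fun x _ y' => f x y') = P.promptMean fun x => ∑ y, ρ.prob x y * f x y := by
  unfold pairMean
  congr 1; funext x
  rw [Finset.sum_comm]
  refine Finset.sum_congr rfl fun y _ => ?_
  rw [← Finset.sum_mul, ← Finset.sum_mul, P.ref.sum_prob, one_mul]

theorem pairMean_const (ρ : Policy X Y) (c : ℝ) : P.pairMean ρ (fun _ _ _ => c) = c := by
  rw [P.pairMean_left ρ fun _ _ => c]
  simp [← Finset.sum_mul, P.ref.sum_prob, promptMean_const]

theorem pairMean_nonneg (ρ : Policy X Y) {f : X → Y → Y → ℝ} (h : ∀ x y y', 0 ≤ f x y y') :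
    0 ≤ P.pairMean ρ f := by
  simpa [P.pairMean_const] using P.pairMean_mono ρ (f := fun _ _ _ => 0) h

theorem abs_pairMean_le (ρ : Policy X Y) {f : X → Y → Y → ℝ} {M : ℝ}
    (h : ∀ x y y', |f x y y'| ≤ M) : |P.pairMean ρ f| ≤ M := by
  rw [abs_le]
  constructor
  · simpa [P.pairMean_const] using
      P.pairMean_mono ρ (f := fun _ _ _ => -M) fun x y y' => (abs_le.1 (h x y y')).1
  · simpa [P.pairMean_const] using
      P.pairMean_mono ρ (g := fun _ _ _ => M) fun x y y' => (abs_le.1 (h x y y')).2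

/-- Nonnegativity of the variance. -/
theorem sq_pairMean_le (ρ : Policy X Y) (f : X → Y → Y → ℝ) :
    P.pairMean ρ f ^ 2 ≤ P.pairMean ρ (fun x y y' => f x y y' ^ 2) := by
  set a := P.pairMean ρ f with ha
  have h := P.pairMean_nonneg ρ (f := fun x y y' => (f x y y' - a) ^ 2) fun x y y' => sq_nonneg _
  have h2 : P.pairMean ρ (fun x y y' => (f x y y' - a) ^ 2)
      = P.pairMean ρ (fun x y y' => f x y y' ^ 2) + ((-2 * a) * a + a ^ 2) := by
    have : (fun x y y' => (f x y y' - a) ^ 2)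
        = fun x y y' => f x y y' ^ 2 + ((-2 * a) * f x y y' + a ^ 2) := by
      funext x y y'; ring
    rw [this, P.pairMean_add ρ (fun x y y' => f x y y' ^ 2),
      P.pairMean_add ρ (fun x y y' => (-2 * a) * f x y y'), P.pairMean_const_mul,
      P.pairMean_const, ← ha]
  rw [h2] at h
  nlinarith

/-! ### The eluder coefficient: existence and attainment -/

variable {P} {𝒞 : Set (Policy X Y)} {πstar : Policy X Y} {R : ℝ}

theorem IsRegularClass.nonneg (h : P.IsRegularClass 𝒞 πstar R) : 0 ≤ R := by
  obtain ⟨x⟩ := P.nonempty_prompts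
  obtain ⟨y⟩ := πstar.nonempty_responses x
  exact (abs_nonneg _).trans (h.bounded _ h.realizable x y)

theorem IsRegularClass.abs_pairError_le (h : P.IsRegularClass 𝒞 πstar R) {π : Policy X Y}
    (hπ : π ∈ 𝒞) (x : X) (y y' : Y) : |P.pairError πstar π x y y'| ≤ 4 * R := by
  have h1 := abs_le.1 (h.bounded _ h.realizable x y)
  have h2 := abs_le.1 (h.bounded _ h.realizable x y')
  have h3 := abs_le.1 (h.bounded _ hπ x y)
  have h4 := abs_le.1 (h.bounded _ hπ x y')
  rw [pairError, abs_le]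
  constructor <;> linarith [h1.1, h1.2, h2.1, h2.2, h3.1, h3.2, h4.1, h4.2]

theorem sum_pairMean_sq_nonneg (P : Problem X Y) (πstar : Policy X Y) (T : ℕ)
    (π : ℕ → Policy X Y) :
    0 ≤ ∑ t ∈ Finset.Icc 1 T, ∑ τ ∈ Finset.Ico 1 t,
      P.pairMean (π τ) (fun x y y' => P.pairError πstar (π t) x y y' ^ 2) :=
  Finset.sum_nonneg fun _ _ => Finset.sum_nonneg fun _ _ =>
    P.pairMean_nonneg _ fun _ _ _ => sq_nonneg _

theorem IsPGECBound.mono {T : ℕ} {d d' : ℝ} (h : P.IsPGECBound 𝒞 πstar T d) (hd : d ≤ d') :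
    P.IsPGECBound 𝒞 πstar T d' := by
  intro π hπ
  refine (h π hπ).trans ?_
  have := P.sum_pairMean_sq_nonneg πstar T π
  gcongr

/-- Errors are at most 4R, so the additive term 4√(dT) = 4RT suffices alone. This makes the set of
admissible constants nonempty, hence its infimum meaningful. -/
theorem IsRegularClass.isPGECBound_sq_mul (h : P.IsRegularClass 𝒞 πstar R) (T : ℕ) :
    P.IsPGECBound 𝒞 πstar T (R ^ 2 * T) := by
  intro π hπ
  have h1 : √(R ^ 2 * T * T) = R * T := by
    rw [show R ^ 2 * T * T = (R * T) ^ 2 by ring]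
    exact Real.sqrt_sq (mul_nonneg h.nonneg (Nat.cast_nonneg _))
  have h2 : ∑ t ∈ Finset.Icc 1 T, P.pairMean (π t) (P.pairError πstar (π t))
      ≤ ∑ _t ∈ Finset.Icc 1 T, 4 * R := Finset.sum_le_sum fun t _ =>
    (le_abs_self _).trans (P.abs_pairMean_le _ (h.abs_pairError_le (hπ t)))
  rw [h1]
  simp only [Finset.sum_const, Nat.card_Icc, add_tsub_cancel_right, nsmul_eq_mul] at h2
  have := Real.sqrt_nonneg (R ^ 2 * T * ∑ t ∈ Finset.Icc 1 T, ∑ τ ∈ Finset.Ico 1 t,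
      P.pairMean (π τ) (fun x y y' => P.pairError πstar (π t) x y y' ^ 2))
  linarith

/-- The smallest constant in the defining inequality is attained. -/
theorem IsRegularClass.isPGECBound_of_pgec_le (h : P.IsRegularClass 𝒞 πstar R) {T : ℕ} {d : ℝ}
    (hd : P.pgec 𝒞 πstar T ≤ d) : P.IsPGECBound 𝒞 πstar T d := by
  refine IsPGECBound.mono ?_ hd
  intro π hπ
  have hne : {d : ℝ | 0 ≤ d ∧ P.IsPGECBound 𝒞 πstar T d}.Nonempty :=
    ⟨R ^ 2 * T, by positivity, h.isPGECBound_sq_mul T⟩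
  set d₀ := P.pgec 𝒞 πstar T with hd₀
  have hlt : ∀ e, d₀ < e → P.IsPGECBound 𝒞 πstar T e := by
    intro e he
    obtain ⟨e', he', hlt⟩ := exists_lt_of_csInf_lt hne he
    exact he'.2.mono hlt.le
  set B := ∑ t ∈ Finset.Icc 1 T, ∑ τ ∈ Finset.Ico 1 t,
    P.pairMean (π τ) (fun x y y' => P.pairError πstar (π t) x y y' ^ 2)
  -- Every e above the infimum is admissible; for a fixed sequence of policies the bound is
  -- continuous in e, so e may decrease to the infimum.
  have hcont : Continuous fun e : ℝ => √(e * B) + 4 * √(e * T) := by fun_prop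
  refine ge_of_tendsto (x := nhdsWithin d₀ (Set.Ioi d₀))
    ((hcont.tendsto d₀).mono_left nhdsWithin_le_nhds) ?_
  filter_upwards [self_mem_nhdsWithin] with e he
  exact hlt e he π hπ

end Problem

/-! ### Log-linear classes -/

variable {k : ℕ} {φ : X → Y → EuclideanSpace ℝ (Fin k)} {Θ : Set (EuclideanSpace ℝ (Fin k))}

/-- In a log-linear class, the pairwise error is linear in the parameter. -/
theorem Problem.IsRegularClass.exists_pairError_eq_inner {P : Problem X Y} {πstar : Policy X Y}
    {R : ℝ} (h : P.IsRegularClass (logLinearClass φ P.β Θ) πstar R) :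
    ∃ w : Policy X Y → EuclideanSpace ℝ (Fin k), ∀ π ∈ logLinearClass φ P.β Θ, ∀ x y y',
      P.pairError πstar π x y y' = inner ℝ (φ x y - φ x y') (w π) / P.β := by
  -- The normalizer cancels in the difference over two responses; the reference terms cancel later,
  -- between πstar and π.
  have key : ∀ π ∈ logLinearClass φ P.β Θ, ∃ θ, ∀ x y y',
      P.logRatio π x y - P.logRatio π x y' = inner ℝ (φ x y - φ x y') θ / P.β
        - (Real.log (P.ref.prob x y) - Real.log (P.ref.prob x y')) := by
    intro π hπ
    obtain ⟨θ, -, hθ⟩ := id hπ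
    refine ⟨θ, fun x y y' => ?_⟩
    have hZ : 0 < ∑ y', Real.exp (inner ℝ (φ x y') θ / P.β) :=
      Finset.sum_pos (fun _ _ => Real.exp_pos _) ⟨y, Finset.mem_univ y⟩
    have hl : ∀ z, P.logRatio π x z = inner ℝ (φ x z) θ / P.β
        - Real.log (∑ y', Real.exp (inner ℝ (φ x y') θ / P.β)) - Real.log (P.ref.prob x z) := by
      intro z
      rw [Problem.logRatio, Real.log_div (h.pos π hπ x z).ne' (h.ref_pos x z).ne', hθ x z,
        Real.log_div (Real.exp_pos _).ne' hZ.ne', Real.log_exp]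
    rw [hl, hl, inner_sub_left]
    ring
  obtain ⟨θs, hθs⟩ := key πstar h.realizable
  choose! θ hθ using key
  refine ⟨fun π => θs - θ π, fun π hπ x y y' => ?_⟩
  have h1 := hθs x y y'
  have h2 := hθ π hπ x y y'
  rw [inner_sub_right, sub_div]
  unfold Problem.pairError
  linarith

/-- The 16 is the square of the 4 in the error range 4R; it is absorbed into ι at the price of a
factor 4. -/
theorem log_one_add_sixteen_mul_le {x : ℝ} (hx : 0 ≤ x) :
    Real.log (1 + 16 * x) ≤ 4 * Real.log (2 + x) := by
  rw [show (4 : ℝ) * Real.log (2 + x) = Real.log ((2 + x) ^ 4) by rw [Real.log_pow]; norm_num]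
  apply Real.log_le_log (by positivity)
  nlinarith [pow_nonneg hx 2, pow_nonneg hx 3, pow_nonneg hx 4]

/-- Mean errors factor as inner products of spanner features and spanner coordinates, to which the
elliptical potential applies; the cost of large-potential rounds is hidden in the term 4√(dT) by
enlarging d. -/
theorem Problem.IsRegularClass.isPGECBound_logLinear {P : Problem X Y} {πstar : Policy X Y}
    {R : ℝ} (h : P.IsRegularClass (logLinearClass φ P.β Θ) πstar R) {T : ℕ} (hT : 1 ≤ T) {ι : ℝ}
    (hι : ι = Real.log (2 + k * T * R ^ 2)) :
    P.IsPGECBound (logLinearClass φ P.β Θ) πstar T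
      (128 * (k * ι) * (1 + R ^ 2 * min 1 (k * ι / T))) := by
  have hR := h.nonneg
  have hT0 : (0 : ℝ) < T := by exact_mod_cast hT
  obtain ⟨w, hw⟩ := h.exists_pairError_eq_inner
  intro π hπ
  rcases Nat.eq_zero_or_pos k with rfl | hk
  · have h0 : ∀ t x y y', P.pairError πstar (π t) x y y' = 0 := by
      intro t x y y'
      rw [hw _ (hπ t), Subsingleton.elim (w (π t)) 0, inner_zero_right, zero_div]
    have : ∀ t, P.pairMean (π t) (P.pairError πstar (π t)) = 0 := by
      intro t
      rw [show P.pairError πstar (π t) = fun _ _ _ => 0 from by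
        funext x y y'; exact h0 t x y y', P.pairMean_const]
    simp only [this, Finset.sum_const_zero]
    positivity
  have hιpos : 0 < ι := by
    rw [hι]
    refine Real.log_pos ?_
    have : (0 : ℝ) ≤ k * T * R ^ 2 := by positivity
    linarith
  obtain ⟨m, hm, u, hu⟩ := exists_barycentric_spanner fun j : Fin (T + 1) => w (π j)
  rw [finrank_euclideanSpace_fin] at hm
  choose c hc hwc using hu
  set F : ℕ → ℕ → ℝ := fun τ t => P.pairMean (π τ) (P.pairError πstar (π t)) with hF
  have hFabs : ∀ τ t, |F τ t| ≤ 4 * R := fun τ t =>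
    P.abs_pairMean_le _ (h.abs_pairError_le (hπ t))
  -- The truncation only extends the coordinates beyond T; the factorization is used for t ≤ T.
  set c' : ℕ → Fin m → ℝ := fun t => c ⟨min t T, by omega⟩ with hc'
  set v : ℕ → Fin m → ℝ := fun τ i => F τ (u i) with hv
  have hdot : ∀ τ, ∀ t ≤ T, dotProduct (v τ) (c' t) = F τ t := by
    intro τ t ht
    have hmin : min t T = t := min_eq_left ht
    have hwt : w (π t) = ∑ i, c' t i • w (π (u i)) := by
      have := hwc ⟨min t T, by omega⟩
      simpa [hmin, hc'] using this
    have he : P.pairError πstar (π t)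
        = fun x y y' => ∑ i, c' t i * P.pairError πstar (π (u i)) x y y' := by
      funext x y y'
      rw [hw _ (hπ t), hwt, inner_sum, Finset.sum_div]
      refine Finset.sum_congr rfl fun i _ => ?_
      rw [hw _ (hπ _), inner_smul_right, mul_div_assoc]
    simp only [hF, hv, dotProduct]
    rw [he, P.pairMean_sum]
    refine Finset.sum_congr rfl fun i _ => ?_
    rw [P.pairMean_const_mul, mul_comm]
  obtain ⟨g, hg0, hg, hgT⟩ := exists_elliptical_potential hm hk (L := 4 * R) v c'
    (fun t i => hFabs _ _) (fun t i => hc _ i) T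
  set b : ℕ → ℝ := fun t => ∑ τ ∈ Finset.Ico 1 t,
    P.pairMean (π τ) (fun x y y' => P.pairError πstar (π t) x y y' ^ 2) with hb
  have hb0 : ∀ t, 0 ≤ b t := fun t => Finset.sum_nonneg fun _ _ =>
    P.pairMean_nonneg _ fun _ _ _ => sq_nonneg _
  have hag : ∀ t ∈ Finset.Icc 1 T, F t t ^ 2 ≤ g t * (1 + b t) := by
    intro t ht
    have htT := (Finset.mem_Icc.1 ht).2
    have h1 := hg t
    rw [hdot t t htT] at h1
    refine h1.trans (mul_le_mul_of_nonneg_left ?_ (hg0 t))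
    refine add_le_add le_rfl (Finset.sum_le_sum fun τ _ => ?_)
    rw [hdot τ t htT]
    exact P.sq_pairMean_le _ _
  have hD : ∑ t ∈ Finset.Icc 1 T, Real.log (1 + g t) ≤ (8 * (k * ι)) / 2 := by
    refine hgT.trans ?_
    have := log_one_add_sixteen_mul_le (show (0 : ℝ) ≤ k * T * R ^ 2 by positivity)
    rw [show (1 : ℝ) + k * T * (4 * R) ^ 2 = 1 + 16 * (k * T * R ^ 2) by ring]
    rw [← hι] at this
    have hk0 : (0 : ℝ) ≤ k := Nat.cast_nonneg k
    nlinarith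
  have hmain := sum_le_of_elliptical_potential (M := 4 * R) (by linarith)
    (fun t => (le_abs_self _).trans (hFabs t t)) hb0 hg0 hag hD
  refine hmain.trans ?_
  set z := k * ι with hz
  have hz0 : 0 < z := mul_pos (by exact_mod_cast hk) hιpos
  set d := 128 * z * (1 + R ^ 2 * min 1 (z / T)) with hd
  have hmn : 0 ≤ min 1 (z / T) := le_min zero_le_one (by positivity)
  have hdz : 8 * z ≤ d := by
    have : 0 ≤ R ^ 2 * min 1 (z / T) := by positivity
    rw [hd]; nlinarith
  have hB : 0 ≤ ∑ t ∈ Finset.Icc 1 T, b t := Finset.sum_nonneg fun t _ => hb0 t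
  have h1 : √(8 * z * ∑ t ∈ Finset.Icc 1 T, b t) ≤ √(d * ∑ t ∈ Finset.Icc 1 T, b t) := by
    gcongr
  have h2 : √(8 * z * T) ≤ √(d * T) := by gcongr
  -- Of the four copies of √(dT), one absorbs √(8zT) and three the large-potential rounds. After
  -- squaring this needs 16 · 64 ≤ 9 · 128, which fits the constant 128.
  have h3 : 4 * R * min (8 * z) T ≤ 3 * √(d * T) := by
    have hsq : (4 * R * min (8 * z) T) ^ 2 ≤ 9 * (d * T) := by
      have e1 : min (8 * z) (T : ℝ) ≤ 8 * (T * min 1 (z / T)) := by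
        rw [mul_min_of_nonneg _ _ hT0.le, mul_one, mul_div_cancel₀ _ hT0.ne']
        rw [mul_min_of_nonneg _ _ (by norm_num : (0 : ℝ) ≤ 8), min_comm]
        exact min_le_min_right _ (by linarith)
      have e2 : 0 ≤ min (8 * z) (T : ℝ) := le_min (by positivity) hT0.le
      have e3 : min (8 * z) (T : ℝ) ^ 2 ≤ 8 * z * (8 * (T * min 1 (z / T))) := by
        rw [sq]
        exact mul_le_mul (min_le_left _ _) e1 e2 (by positivity)
      have e4 : 9 * (d * T) = 1152 * z * T + 1152 * (R ^ 2 * (z * (T * min 1 (z / T)))) := by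
        rw [hd]; ring
      have e5 : 0 ≤ R ^ 2 * (z * (T * min 1 (z / T))) := by positivity
      have e6 : 0 ≤ z * (T : ℝ) := by positivity
      have e7 := mul_le_mul_of_nonneg_left e3 (sq_nonneg R)
      nlinarith
    have : 3 * √(d * T) = √(9 * (d * T)) := by
      rw [Real.sqrt_mul (by norm_num : (0 : ℝ) ≤ 9), show (9 : ℝ) = 3 ^ 2 by norm_num,
        Real.sqrt_sq (by norm_num)]
    rw [this]
    exact Real.le_sqrt_of_sq_le hsq
  linarith

end SELM

/-! ### Maximal inequality and time-uniform Chernoff bound -/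

/-- Ville's maximal inequality on a finite horizon, for a nonnegative process whose integrals over
past events decrease. -/
theorem measureReal_exists_le_of_setIntegral_le {Ω : Type*} {mΩ : MeasurableSpace Ω}
    {μ : Measure Ω} [IsFiniteMeasure μ] {ℱ : Filtration ℕ mΩ} {M : ℕ → Ω → ℝ} {T : ℕ} {c : ℝ}
    (hM0 : ∀ t ω, 0 ≤ M t ω) (hmeas : ∀ t ≤ T, Measurable[ℱ t] (M t))
    (hint : ∀ t ≤ T, Integrable (M t) μ)
    (hstep : ∀ t < T, ∀ A, MeasurableSet[ℱ t] A → ∫ ω in A, M (t + 1) ω ∂μ ≤ ∫ ω in A, M t ω ∂μ) :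
    MeasurableSet {ω | ∃ t ≤ T, c ≤ M t ω} ∧
      c * μ.real {ω | ∃ t ≤ T, c ≤ M t ω} ≤ ∫ ω, M 0 ω ∂μ := by
  set B : ℕ → Set Ω := fun n => {ω | ∃ t ≤ n, c ≤ M t ω} with hB
  have hBsucc : ∀ n, B (n + 1) = B n ∪ {ω | c ≤ M (n + 1) ω} := by
    intro n
    ext ω
    simp only [hB, Set.mem_ofPred_eq, Set.mem_union]
    constructor
    · rintro ⟨t, ht, h⟩
      rcases Nat.le_succ_iff.1 ht with h' | rfl
      · exact Or.inl ⟨t, h', h⟩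
      · exact Or.inr h
    · rintro (⟨t, ht, h⟩ | h)
      · exact ⟨t, by omega, h⟩
      · exact ⟨n + 1, le_rfl, h⟩
  have hBmeas : ∀ n ≤ T, MeasurableSet[ℱ n] (B n) := by
    intro n hn
    have : B n = ⋃ t ∈ Finset.range (n + 1), {ω | c ≤ M t ω} := by
      ext ω; simp [hB]
    rw [this]
    refine Finset.measurableSet_biUnion _ fun t ht => ?_
    have htn : t ≤ n := Nat.lt_succ_iff.1 (Finset.mem_range.1 ht)
    exact ℱ.mono htn _ (measurableSet_le measurable_const (hmeas t (htn.trans hn)))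
  have hmarkov : ∀ A, MeasurableSet A → ∀ n ≤ T,
      c * μ.real (A ∩ {ω | c ≤ M n ω}) + ∫ ω in A \ {ω | c ≤ M n ω}, M n ω ∂μ
        ≤ ∫ ω in A, M n ω ∂μ := by
    intro A hA n hn
    have hS : MeasurableSet {ω | c ≤ M n ω} :=
      ℱ.le n _ (measurableSet_le measurable_const (hmeas n hn))
    rw [← integral_inter_add_sdiff (s := A) hS (hint n hn).integrableOn]
    refine add_le_add ?_ le_rfl
    calc c * μ.real (A ∩ {ω | c ≤ M n ω}) = ∫ _ω in A ∩ {ω | c ≤ M n ω}, c ∂μ := by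
          simp [mul_comm]
      _ ≤ _ := setIntegral_mono_on (integrable_const _).integrableOn (hint n hn).integrableOn
          (hA.inter hS) fun ω hω => hω.2
  -- The left side bounds from below the mean of the process stopped at its first crossing of c.
  have key : ∀ n ≤ T, c * μ.real (B n) + ∫ ω in (B n)ᶜ, M n ω ∂μ ≤ ∫ ω, M 0 ω ∂μ := by
    intro n
    induction n with
    | zero =>
      intro h
      have := hmarkov Set.univ MeasurableSet.univ 0 h
      have hB0 : B 0 = {ω | c ≤ M 0 ω} := by ext ω; simp [hB]
      rw [hB0, Set.compl_eq_univ_sdiff]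
      simpa using this
    | succ n ih =>
      intro hn
      have h1 := ih (by omega)
      have h2 := hstep n (by omega) (B n)ᶜ (hBmeas n (by omega)).compl
      have hBm : MeasurableSet (B n) := ℱ.le n _ (hBmeas n (by omega))
      have h3 := hmarkov (B n)ᶜ hBm.compl (n + 1) hn
      have h4 : (B (n + 1))ᶜ = (B n)ᶜ \ {ω | c ≤ M (n + 1) ω} := by
        rw [hBsucc, Set.compl_union, Set.sdiff_eq]
      have hS : MeasurableSet {ω | c ≤ M (n + 1) ω} :=
        ℱ.le _ _ (measurableSet_le measurable_const (hmeas _ hn))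
      have h5 : μ.real (B (n + 1))
          = μ.real (B n) + μ.real ((B n)ᶜ ∩ {ω | c ≤ M (n + 1) ω}) := by
        have h6 : B (n + 1) = B n ∪ ((B n)ᶜ ∩ {ω | c ≤ M (n + 1) ω}) := by
          rw [hBsucc]; ext ω; simp only [Set.mem_union, Set.mem_inter_iff, Set.mem_compl_iff]; tauto
        rw [h6]
        refine measureReal_union ?_ (hBm.compl.inter hS)
        exact Set.disjoint_left.2 fun ω h h' => h'.1 h
      rw [h4, h5, mul_add]
      linarith
  refine ⟨ℱ.le T _ (hBmeas T le_rfl), ?_⟩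
  have := key T le_rfl
  have h0 : 0 ≤ ∫ ω in (B T)ᶜ, M T ω ∂μ := integral_nonneg fun ω => hM0 T ω
  linarith

/-- Time-uniform Chernoff bound for a function of finitely-valued observations with known
conditional laws. -/
theorem measureReal_exists_le_exp_sum {Ω 𝒮 : Type*} [Fintype 𝒮] {mΩ : MeasurableSpace Ω}
    {μ : Measure Ω} [IsProbabilityMeasure μ] {ℱ : Filtration ℕ mΩ} {T : ℕ} {S : ℕ → Ω → 𝒮}
    {q : ℕ → Ω → 𝒮 → ℝ} {f : 𝒮 → ℝ} {h : ℕ → Ω → ℝ} {K c : ℝ} (hc : 0 < c)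
    (hS : ∀ t < T, ∀ s, MeasurableSet[ℱ (t + 1)] {ω | S (t + 1) ω = s})
    (hq : ∀ t < T, ∀ s,
      μ[({ω | S (t + 1) ω = s}).indicator (fun _ => (1 : ℝ)) | ℱ t] =ᵐ[μ] fun ω => q t ω s)
    (hh : ∀ t < T, Measurable[ℱ t] (h t)) (hK : ∀ t < T, ∀ ω, |h t ω| ≤ K)
    (hqf : ∀ t < T, ∀ ω, ∑ s, q t ω s * Real.exp (f s) ≤ Real.exp (-h t ω)) :
    MeasurableSet {ω | ∃ t ≤ T, c ≤ Real.exp (∑ i ∈ Finset.range t, (f (S (i + 1) ω) + h i ω))} ∧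
    μ.real {ω | ∃ t ≤ T, c ≤ Real.exp (∑ i ∈ Finset.range t, (f (S (i + 1) ω) + h i ω))}
      ≤ 1 / c := by
  classical
  let _ : MeasurableSpace 𝒮 := ⊤
  set M : ℕ → Ω → ℝ := fun t ω => Real.exp (∑ i ∈ Finset.range t, (f (S (i + 1) ω) + h i ω))
    with hMdef
  have hSm : ∀ t < T, Measurable[ℱ (t + 1)] (S (t + 1)) := fun t ht =>
    @measurable_to_countable' _ _ _ _ (ℱ (t + 1)) _ fun s => hS t ht s
  have hmeas : ∀ t ≤ T, Measurable[ℱ t] (M t) := by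
    intro t ht
    refine Real.measurable_exp.comp ?_
    refine Finset.measurable_sum _ fun i hi => ?_
    have hit := Finset.mem_range.1 hi
    refine Measurable.add ?_ ?_
    · exact (measurable_from_top (f := f)).comp
        ((hSm i (by omega)).mono (ℱ.mono (by omega)) le_rfl)
    · exact (hh i (by omega)).mono (ℱ.mono (by omega)) le_rfl
  have hf : ∀ s, |f s| ≤ ∑ s, |f s| := fun s =>
    Finset.single_le_sum (f := fun s => |f s|) (fun _ _ => abs_nonneg _) (Finset.mem_univ s)
  have hbd : ∀ t ≤ T, ∀ ω, ‖M t ω‖ ≤ Real.exp (t * (∑ s, |f s| + K)) := by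
    intro t ht ω
    rw [Real.norm_of_nonneg (Real.exp_pos _).le]
    refine Real.exp_le_exp.2 ?_
    calc _ ≤ ∑ _i ∈ Finset.range t, (∑ s, |f s| + K) := Finset.sum_le_sum fun i hi => by
          have hit := Finset.mem_range.1 hi
          exact add_le_add ((le_abs_self _).trans (hf _))
            ((le_abs_self _).trans (hK i (by omega) ω))
      _ = _ := by simp [mul_add]
  have hint : ∀ t ≤ T, Integrable (M t) μ := fun t ht =>
    Integrable.of_bound ((hmeas t ht).mono (ℱ.le t) le_rfl).aestronglyMeasurable _
      (Filter.Eventually.of_forall (hbd t ht))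
  have hstep : ∀ t < T, ∀ A, MeasurableSet[ℱ t] A →
      ∫ ω in A, M (t + 1) ω ∂μ ≤ ∫ ω in A, M t ω ∂μ := by
    intro t ht A hA
    set I : 𝒮 → Ω → ℝ := fun s => ({ω | S (t + 1) ω = s}).indicator (fun _ => (1 : ℝ)) with hI
    set Z : 𝒮 → Ω → ℝ := fun s ω => M t ω * Real.exp (h t ω) * Real.exp (f s) with hZ
    have hZm : ∀ s, Measurable[ℱ t] (Z s) := fun s =>
      ((hmeas t ht.le).mul (Real.measurable_exp.comp (hh t ht))).mul measurable_const
    have hZb : ∀ s ω, ‖Z s ω‖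
        ≤ Real.exp (t * (∑ s, |f s| + K)) * Real.exp K * Real.exp (f s) := by
      intro s ω
      simp only [hZ, norm_mul, Real.norm_of_nonneg (Real.exp_pos _).le]
      have h1 := hbd t ht.le ω
      have h2 : Real.exp (h t ω) ≤ Real.exp K :=
        Real.exp_le_exp.2 ((le_abs_self _).trans (hK t ht ω))
      gcongr
    have hIint : ∀ s, Integrable (I s) μ := fun s =>
      (integrable_const (1 : ℝ)).indicator (ℱ.le _ _ (hS t ht s))
    have hZI : ∀ s, Integrable (Z s * I s) μ := fun s =>
      (hIint s).bdd_mul ((hZm s).mono (ℱ.le t) le_rfl).aestronglyMeasurable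
        (Filter.Eventually.of_forall (hZb s))
    have hqi : ∀ s, Integrable (fun ω => q t ω s) μ := fun s =>
      integrable_condExp.congr (hq t ht s)
    have hZq : ∀ s, Integrable (fun ω => Z s ω * q t ω s) μ := fun s =>
      (hqi s).bdd_mul ((hZm s).mono (ℱ.le t) le_rfl).aestronglyMeasurable
        (Filter.Eventually.of_forall (hZb s))
    -- Splitting by the value of the next observation leaves only conditional expectations of
    -- indicators, with factors known at time t.
    have hsplit : ∀ ω, M (t + 1) ω = ∑ s, (Z s * I s) ω := by
      intro ω
      rw [Finset.sum_eq_single (S (t + 1) ω)]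
      · simp only [hMdef, hZ, hI, Pi.mul_apply, Set.indicator, Set.mem_ofPred_eq, if_true, mul_one,
          Finset.sum_range_succ, ← Real.exp_add]
        congr 1; ring
      · intro s _ hs
        simp [hI, Set.indicator, Ne.symm hs]
      · simp
    have hcond : ∀ s, ∫ ω in A, (Z s * I s) ω ∂μ = ∫ ω in A, Z s ω * q t ω s ∂μ := by
      intro s
      rw [← setIntegral_condExp (ℱ.le t) (hZI s) hA]
      refine setIntegral_congr_ae (ℱ.le t _ hA) ?_
      filter_upwards [condExp_mul_of_stronglyMeasurable_left (hZm s).stronglyMeasurable (hZI s)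
        (hIint s), hq t ht s] with ω h1 h2 _
      rw [h1, Pi.mul_apply, h2]
    calc ∫ ω in A, M (t + 1) ω ∂μ = ∑ s, ∫ ω in A, (Z s * I s) ω ∂μ := by
          simp_rw [hsplit]
          exact integral_finsetSum _ fun s _ => (hZI s).integrableOn
      _ = ∫ ω in A, ∑ s, Z s ω * q t ω s ∂μ := by
          rw [integral_finsetSum _ fun s _ => (hZq s).integrableOn]
          exact Finset.sum_congr rfl fun s _ => hcond s
      _ ≤ ∫ ω in A, M t ω ∂μ := by
          refine setIntegral_mono (integrable_finsetSum _ fun s _ => hZq s).integrableOn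
            (hint t ht.le).integrableOn fun ω => ?_
          have h1 : ∑ s, Z s ω * q t ω s
              = M t ω * Real.exp (h t ω) * ∑ s, q t ω s * Real.exp (f s) := by
            rw [Finset.mul_sum]
            exact Finset.sum_congr rfl fun s _ => by simp only [hZ]; ring
          have h2 : M t ω * Real.exp (h t ω) * Real.exp (-h t ω) = M t ω := by
            rw [mul_assoc, ← Real.exp_add, add_neg_cancel, Real.exp_zero, mul_one]
          calc _ = _ := h1
            _ ≤ M t ω * Real.exp (h t ω) * Real.exp (-h t ω) :=
              mul_le_mul_of_nonneg_left (hqf t ht ω)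
                (mul_nonneg (Real.exp_pos _).le (Real.exp_pos _).le)
            _ = M t ω := h2
  have hM0 : ∀ t ω, 0 ≤ M t ω := fun t ω => (Real.exp_pos _).le
  obtain ⟨h1, h2⟩ := measureReal_exists_le_of_setIntegral_le (c := c) hM0 hmeas hint hstep
  refine ⟨h1, ?_⟩
  rw [le_div_iff₀ hc, mul_comm]
  simpa [hMdef] using h2

/-! ### Affinity of preference laws -/

/-- The Bhattacharyya affinity of two Bernoulli laws with bounded logits. -/
theorem Real.sqrt_sigmoid_mul_add_le {u v M : ℝ} (hu : |u| ≤ M) (hv : |v| ≤ M) :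
    √(sigmoid u * sigmoid v) + √(sigmoid (-u) * sigmoid (-v))
      ≤ 1 - (u - v) ^ 2 * exp (-M) / 32 := by
  set a := exp (u / 2) with ha
  set b := exp (v / 2) with hb
  have ha0 : 0 < a := exp_pos _
  have hb0 : 0 < b := exp_pos _
  have hone : ∀ w : ℝ, |w| ≤ M → 1 + exp (w / 2) ^ 2 ≤ 2 * exp (w / 2) * exp (M / 2) := by
    intro w hw
    have h1 : exp (-w / 2) ≤ exp (M / 2) := exp_le_exp.2 (by linarith [(abs_le.1 hw).1])
    have h2 : exp (w / 2) ≤ exp (M / 2) := exp_le_exp.2 (by linarith [(abs_le.1 hw).2])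
    have h3 : exp (w / 2) * exp (-w / 2) = 1 := by
      rw [← exp_add]; ring_nf; exact exp_zero
    nlinarith [exp_pos (w / 2)]
  have hs : ∀ w : ℝ, sigmoid w = exp (w / 2) ^ 2 / (1 + exp (w / 2) ^ 2) := by
    intro w
    rw [sigmoid_def, exp_neg, ← exp_nat_mul]
    push_cast
    rw [show 2 * (w / 2) = w by ring]
    have := exp_pos w
    field_simp
    ring
  have hs' : ∀ w : ℝ, sigmoid (-w) = 1 / (1 + exp (w / 2) ^ 2) := by
    intro w
    rw [sigmoid_neg, hs]
    have := exp_pos (w / 2)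
    field_simp
    ring
  set W := √((1 + a ^ 2) * (1 + b ^ 2)) with hW
  have hWsq : W ^ 2 = (1 + a ^ 2) * (1 + b ^ 2) := sq_sqrt (by positivity)
  have hW0 : 0 < W := sqrt_pos.2 (by positivity)
  have e1 : √(sigmoid u * sigmoid v) = a * b / W := by
    rw [hs, hs, div_mul_div_comm, ← mul_pow, sqrt_div (by positivity), sqrt_sq (by positivity)]
  have e2 : √(sigmoid (-u) * sigmoid (-v)) = 1 / W := by
    rw [hs', hs', div_mul_div_comm, one_mul, sqrt_div (by norm_num), sqrt_one]
  rw [e1, e2, ← add_div]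
  set q := (u - v) ^ 2 * exp (-M) / 32 with hq
  have hq0 : 0 ≤ q := by positivity
  -- With the geometric mean factored out, a - b is a hyperbolic sine, and |sinh x| ≥ |x|.
  have hsinh : a * b * (u - v) ^ 2 / 4 ≤ (a - b) ^ 2 := by
    have h1 : a - b = 2 * exp ((u + v) / 4) * sinh ((u - v) / 4) := by
      rw [sinh_eq, ha, hb]
      have e3 : exp (u / 2) = exp ((u + v) / 4) * exp ((u - v) / 4) := by
        rw [← exp_add]; ring_nf
      have e4 : exp (v / 2) = exp ((u + v) / 4) * exp (-((u - v) / 4)) := by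
        rw [← exp_add]; ring_nf
      rw [e3, e4]; ring
    have h2 : a * b = exp ((u + v) / 4) ^ 2 := by
      rw [ha, hb, ← exp_add, ← exp_nat_mul]; push_cast; ring_nf
    have h3 : ((u - v) / 4) ^ 2 ≤ sinh ((u - v) / 4) ^ 2 := by
      rw [sq_le_sq, abs_sinh]
      exact self_le_sinh_iff.2 (abs_nonneg _)
    rw [h1, h2, mul_pow, mul_pow]
    have := mul_le_mul_of_nonneg_left h3 (sq_nonneg (exp ((u + v) / 4)))
    nlinarith
  have hprod : (1 + a ^ 2) * (1 + b ^ 2) ≤ 4 * (a * b) * exp M := by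
    have h1 := hone u hu
    have h2 := hone v hv
    have h3 : exp (M / 2) * exp (M / 2) = exp M := by rw [← exp_add]; ring_nf
    calc _ ≤ (2 * a * exp (M / 2)) * (2 * b * exp (M / 2)) :=
          mul_le_mul h1 h2 (by positivity) (by positivity)
      _ = 4 * (a * b) * (exp (M / 2) * exp (M / 2)) := by ring
      _ = _ := by rw [h3]
  have hkey : 2 * q * W ^ 2 ≤ (a - b) ^ 2 := by
    have hMM : exp (-M) * exp M = 1 := by rw [← exp_add, neg_add_cancel, exp_zero]
    rw [hWsq]
    calc _ ≤ 2 * q * (4 * (a * b) * exp M) := by gcongr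
      _ = a * b * (u - v) ^ 2 / 4 * (exp (-M) * exp M) := by rw [hq]; ring
      _ = a * b * (u - v) ^ 2 / 4 := by rw [hMM, mul_one]
      _ ≤ _ := hsinh
  -- The affinity is (ab + 1)/W, so its squared deficit is (a - b)²/W², at least 2q by `hkey`.
  have hW1 : W ^ 2 = (a * b + 1) ^ 2 + (a - b) ^ 2 := by rw [hWsq]; ring
  have hpos : 0 < (a * b + 1) := by positivity
  have h12 : 2 * q < 1 := by
    by_contra hcon
    nlinarith [sq_nonneg W]
  rw [div_le_iff₀ hW0]
  refine le_of_sq_le_sq ?_ (mul_nonneg (by linarith) hW0.le)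
  rw [mul_pow]
  nlinarith [mul_nonneg (sq_nonneg q) (sq_nonneg W)]

/-! ### Gibbs form of the optimum and likelihood ratios -/

namespace SELM

/-- Comparisons as tuples. -/
def Comparison.equivProd (X Y : Type*) : Comparison X Y ≃ X × Y × Y × Bool where
  toFun s := (s.x, s.y₁, s.y₂, s.label)
  invFun p := ⟨p.1, p.2.1, p.2.2.1, p.2.2.2⟩
  left_inv _ := rfl
  right_inv _ := rfl

noncomputable instance (X Y : Type*) [Fintype X] [Fintype Y] : Fintype (Comparison X Y) :=
  Fintype.ofEquiv _ (Comparison.equivProd X Y).symm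

variable {X Y : Type*} [Fintype X] [Fintype Y]

theorem Comparison.sum_eq (f : Comparison X Y → ℝ) :
    ∑ s, f s = ∑ x, ∑ y, ∑ y', (f ⟨x, y, y', true⟩ + f ⟨x, y, y', false⟩) := by
  rw [← Equiv.sum_comp (Comparison.equivProd X Y).symm f]
  simp [Fintype.sum_prod_type, Comparison.equivProd]

namespace Problem

variable {P : Problem X Y} {𝒞 : Set (Policy X Y)} {πstar : Policy X Y} {R : ℝ}

open Classical in
/-- An optimal policy is the Gibbs policy of the reward, on the support of `ν`. -/
theorem IsRegularClass.exists_reward_eq (h : P.IsRegularClass 𝒞 πstar R) (x : X)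
    (hx : 0 < (P.ν : X → ℝ) x) :
    ∃ c, ∀ y, P.r x y = P.β * P.logRatio πstar x y + c := by
  have hβ := P.β_pos
  have hpos := h.pos _ h.realizable x
  have href := h.ref_pos x
  obtain ⟨y₀⟩ := πstar.nonempty_responses x
  set Z := ∑ y, P.ref.prob x y * Real.exp (P.r x y / P.β) with hZ
  have hZ0 : 0 < Z := Finset.sum_pos (fun y _ => mul_pos (href y) (Real.exp_pos _)) ⟨y₀, Finset.mem_univ _⟩
  set g : Y → ℝ := fun y => P.ref.prob x y * Real.exp (P.r x y / P.β) / Z with hg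
  have hg0 : ∀ y, 0 < g y := fun y => div_pos (mul_pos (href y) (Real.exp_pos _)) hZ0
  have hg1 : ∑ y, g y = 1 := by
    simp only [hg]
    rw [← Finset.sum_div, div_self hZ0.ne']
  have hr : ∀ y, P.r x y = P.β * (Real.log (g y) - Real.log (P.ref.prob x y)) + P.β * Real.log Z := by
    intro y
    simp only [hg]
    rw [Real.log_div (mul_pos (href y) (Real.exp_pos _)).ne' hZ0.ne',
      Real.log_mul (href y).ne' (Real.exp_pos _).ne', Real.log_exp]
    field_simp
    ring
  let gp : stdSimplex ℝ Y := ⟨g, fun y => (hg0 y).le, hg1⟩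
  -- Deviating at the single prompt x is enough: its positive mass turns a gain there into a gain in
  -- value.
  let π' : Policy X Y := Function.update πstar x gp
  have hπx : ∀ y, π'.prob x y = g y := fun y => by
    simp only [π', Policy.prob, Function.update_self]; rfl
  have hπo : ∀ x', x' ≠ x → ∀ y, π'.prob x' y = πstar.prob x' y := fun x' hx' y => by
    simp [π', Policy.prob, hx']
  have hopt := h.optimal π'
  have hdiff : P.value π' - P.value πstar = (P.ν : X → ℝ) x *
      (∑ y, π'.prob x y * (P.r x y - P.β * P.logRatio π' x y)
        - ∑ y, πstar.prob x y * (P.r x y - P.β * P.logRatio πstar x y)) := by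
    rw [value, value, promptMean, promptMean, ← Finset.sum_sub_distrib,
      Finset.sum_eq_single x, mul_sub]
    · intro x' _ hx'
      simp [logRatio, hπo x' hx']
    · simp
  have hVg : ∑ y, π'.prob x y * (P.r x y - P.β * P.logRatio π' x y) = P.β * Real.log Z := by
    calc _ = ∑ y, g y * (P.β * Real.log Z) := Finset.sum_congr rfl fun y _ => by
          rw [logRatio, hπx, hr, Real.log_div (hg0 y).ne' (href y).ne']; ring
      _ = _ := by rw [← Finset.sum_mul, hg1, one_mul]
  have hVs : ∑ y, πstar.prob x y * (P.r x y - P.β * P.logRatio πstar x y)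
      = P.β * Real.log Z + P.β * ∑ y, πstar.prob x y * Real.log (g y / πstar.prob x y) := by
    calc _ = ∑ y, (πstar.prob x y * (P.β * Real.log Z)
            + P.β * (πstar.prob x y * Real.log (g y / πstar.prob x y))) :=
          Finset.sum_congr rfl fun y _ => by
            rw [logRatio, hr, Real.log_div (hpos y).ne' (href y).ne',
              Real.log_div (hg0 y).ne' (hpos y).ne']; ring
      _ = _ := by
          rw [Finset.sum_add_distrib, ← Finset.sum_mul, πstar.sum_prob, one_mul, ← Finset.mul_sum]
  -- The sum is minus the divergence of πstar from g. Being nonnegative, it forces equality in log t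
  -- ≤ t - 1 at every response.
  have hKL : 0 ≤ ∑ y, πstar.prob x y * Real.log (g y / πstar.prob x y) := by
    by_contra hneg
    push Not at hneg
    have h1 : 0 < P.value π' - P.value πstar := by
      rw [hdiff, hVg, hVs]
      refine mul_pos hx ?_
      have := mul_neg_of_pos_of_neg hβ hneg
      linarith
    linarith
  have hle : ∀ y, πstar.prob x y * Real.log (g y / πstar.prob x y) ≤ g y - πstar.prob x y := by
    intro y
    have := Real.log_le_sub_one_of_pos (div_pos (hg0 y) (hpos y))
    calc _ ≤ πstar.prob x y * (g y / πstar.prob x y - 1) :=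
          mul_le_mul_of_nonneg_left this (hpos y).le
      _ = _ := by have := (hpos y).ne'; field_simp
  have hsum : ∑ y, (g y - πstar.prob x y) = 0 := by
    rw [Finset.sum_sub_distrib, hg1, πstar.sum_prob, sub_self]
  have heq : ∀ y, g y = πstar.prob x y := by
    have hall := (Finset.sum_eq_sum_iff_of_le (s := Finset.univ) fun y _ => hle y).1
      (le_antisymm (Finset.sum_le_sum fun y _ => hle y) (by rw [hsum]; exact hKL))
    intro y
    by_contra hne
    have h1 : g y / πstar.prob x y ≠ 1 := by
      rw [Ne, div_eq_one_iff_eq (hpos y).ne']; exact hne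
    have h2 := Real.log_lt_sub_one_of_pos (div_pos (hg0 y) (hpos y)) h1
    have h3 := mul_lt_mul_of_pos_left h2 (hpos y)
    rw [hall y (Finset.mem_univ y), mul_sub, mul_div_cancel₀ _ (hpos y).ne', mul_one] at h3
    exact lt_irrefl _ h3
  refine ⟨P.β * Real.log Z, fun y => ?_⟩
  rw [hr, heq, logRatio, Real.log_div (hpos y).ne' (href y).ne']

/-- `𝔼_{x ∼ ν, y ∼ π_ref} [log π(y ∣ x)]`. -/
noncomputable def refLog (P : Problem X Y) (π : Policy X Y) : ℝ :=
  P.promptMean fun x => ∑ y, P.ref.prob x y * Real.log (π.prob x y)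

/-- The value gap is the mean pairwise error plus a reference log-likelihood gap. -/
theorem IsRegularClass.value_sub_eq (h : P.IsRegularClass 𝒞 πstar R) {π : Policy X Y}
    (hπ : π ∈ 𝒞) :
    P.value πstar - P.value π = P.β * P.pairMean π (P.pairError πstar π)
      + P.β * (P.refLog π - P.refLog πstar) := by
  have hc : ∀ x, ∃ c, 0 < (P.ν : X → ℝ) x → ∀ y, P.r x y = P.β * P.logRatio πstar x y + c := by
    intro x
    by_cases hx : 0 < (P.ν : X → ℝ) x
    · obtain ⟨c, hc⟩ := h.exists_reward_eq x hx
      exact ⟨c, fun _ => hc⟩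
    · exact ⟨0, fun h' => absurd h' hx⟩
  choose c hc using hc
  have hval : ∀ ρ : Policy X Y, P.value ρ = P.promptMean c
      + P.β * P.promptMean fun x => ∑ y, ρ.prob x y * (P.logRatio πstar x y - P.logRatio ρ x y) := by
    intro ρ
    rw [value, ← promptMean_const_mul, ← promptMean_add]
    refine P.promptMean_congr fun x hx => ?_
    calc _ = ∑ y, (ρ.prob x y * c x
          + P.β * (ρ.prob x y * (P.logRatio πstar x y - P.logRatio ρ x y))) :=
          Finset.sum_congr rfl fun y _ => by rw [hc x hx]; ring
      _ = _ := by
          rw [Finset.sum_add_distrib, ← Finset.sum_mul, ρ.sum_prob, one_mul, ← Finset.mul_sum]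
  have hpair : P.pairMean π (P.pairError πstar π)
      = (P.refLog πstar - P.refLog π)
        - P.promptMean fun x => ∑ y, π.prob x y * (P.logRatio πstar x y - P.logRatio π x y) := by
    have h1 : P.pairError πstar π = fun x y y' =>
        (P.logRatio πstar x y - P.logRatio π x y)
          + (-1) * (P.logRatio πstar x y' - P.logRatio π x y') := by
      funext x y y'; rw [pairError]; ring
    rw [h1, P.pairMean_add π (fun x y _ => P.logRatio πstar x y - P.logRatio π x y),
      P.pairMean_const_mul π (-1) (fun x _ y' => P.logRatio πstar x y' - P.logRatio π x y'),
      P.pairMean_left π (fun x y => P.logRatio πstar x y - P.logRatio π x y),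
      P.pairMean_right π (fun x y => P.logRatio πstar x y - P.logRatio π x y),
      refLog, refLog, ← promptMean_sub]
    have h2 : (fun x => ∑ y, P.ref.prob x y * (P.logRatio πstar x y - P.logRatio π x y))
        = fun x => ∑ y, P.ref.prob x y * Real.log (πstar.prob x y)
          - ∑ y, P.ref.prob x y * Real.log (π.prob x y) := by
      funext x
      rw [← Finset.sum_sub_distrib]
      refine Finset.sum_congr rfl fun y _ => ?_
      rw [logRatio, logRatio, Real.log_div (h.pos _ h.realizable x y).ne' (h.ref_pos x y).ne',
        Real.log_div (h.pos _ hπ x y).ne' (h.ref_pos x y).ne']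
      ring
    rw [h2]; ring
  have hstar : (P.promptMean fun x => ∑ y, πstar.prob x y *
      (P.logRatio πstar x y - P.logRatio πstar x y)) = 0 := by
    simp [promptMean]
  rw [hval πstar, hval π, hpair, hstar]
  ring

/-- The log-likelihood of a comparison under the preference model induced by `π`. -/
noncomputable def logLik (P : Problem X Y) (π : Policy X Y) (s : Comparison X Y) : ℝ :=
  Real.log (Real.sigmoid
    (P.β * P.logRatio π s.x s.chosen - P.β * P.logRatio π s.x s.rejected))

/-- Affinity of the preference laws of `π` and of the true preferences, in terms of the pairwise
error. -/
theorem IsRegularClass.sum_comparisonProb_le (h : P.IsRegularClass 𝒞 πstar R) {π : Policy X Y}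
    (hπ : π ∈ 𝒞) (ρ : Policy X Y) :
    ∑ s, P.comparisonProb ρ s * Real.exp ((P.logLik π s - P.logLik πstar s) / 2)
      ≤ Real.exp (-(P.β ^ 2 * Real.exp (-(2 * P.β * R)) / 32 *
          P.pairMean ρ (fun x y y' => P.pairError πstar π x y y' ^ 2))) := by
  have hβ := P.β_pos
  set κ := P.β ^ 2 * Real.exp (-(2 * P.β * R)) / 32 with hκ
  -- The exponent 1/2 is chosen for p√(q/p) = √(pq), which sums over the two labels to the affinity.
  have hexp : ∀ u v : ℝ, Real.sigmoid v *
      Real.exp ((Real.log (Real.sigmoid u) - Real.log (Real.sigmoid v)) / 2)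
      = √(Real.sigmoid u * Real.sigmoid v) := by
    intro u v
    have hu := Real.sigmoid_pos u
    have hv := Real.sigmoid_pos v
    symm
    rw [Real.sqrt_eq_iff_mul_self_eq (by positivity) (by positivity)]
    rw [mul_mul_mul_comm, ← Real.exp_add, add_halves, Real.exp_sub, Real.exp_log hu,
      Real.exp_log hv]
    field_simp
  have hbound : ∀ π' ∈ 𝒞, ∀ x y y',
      |P.β * P.logRatio π' x y - P.β * P.logRatio π' x y'| ≤ 2 * P.β * R := by
    intro π' hπ' x y y'
    have h1 := abs_le.1 (h.bounded _ hπ' x y)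
    have h2 := abs_le.1 (h.bounded _ hπ' x y')
    rw [← mul_sub, abs_mul, abs_of_pos hβ, show 2 * P.β * R = P.β * (2 * R) by ring]
    refine mul_le_mul_of_nonneg_left ?_ hβ.le
    rw [abs_le]; constructor <;> linarith [h1.1, h1.2, h2.1, h2.2]
  have hmain : ∑ s, P.comparisonProb ρ s * Real.exp ((P.logLik π s - P.logLik πstar s) / 2)
      ≤ P.promptMean fun x => ∑ y, ∑ y', P.ref.prob x y * ρ.prob x y' *
          (1 + -κ * P.pairError πstar π x y y' ^ 2) := by
    rw [Comparison.sum_eq, promptMean]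
    refine Finset.sum_le_sum fun x _ => ?_
    rcases (P.ν_nonneg x).eq_or_lt with hx | hx
    · simp [comparisonProb, ← hx]
    obtain ⟨c, hc⟩ := h.exists_reward_eq x hx
    have hpref : ∀ y y', P.prefProb x y y' = Real.sigmoid
        (P.β * P.logRatio πstar x y - P.β * P.logRatio πstar x y') := by
      intro y y'
      rw [prefProb, hc, hc]; ring_nf
    rw [Finset.mul_sum, Finset.sum_comm]
    refine Finset.sum_le_sum fun y _ => ?_
    rw [Finset.mul_sum]
    refine Finset.sum_le_sum fun y' _ => ?_
    -- Here y' is the first response, drawn from ρ, and y the second: the reverse of the order in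
    -- `pairMean`. The sign is lost in the square.
    set u := P.β * P.logRatio π x y' - P.β * P.logRatio π x y with hu
    set v := P.β * P.logRatio πstar x y' - P.β * P.logRatio πstar x y with hv
    have hBC := Real.sqrt_sigmoid_mul_add_le (hbound π hπ x y' y)
      (hbound πstar h.realizable x y' y)
    rw [← hu, ← hv] at hBC
    have hdu : (u - v) ^ 2 * Real.exp (-(2 * P.β * R)) / 32
        = κ * P.pairError πstar π x y y' ^ 2 := by
      rw [hκ, hu, hv, pairError]; ring
    have hnu : P.β * P.logRatio π x y - P.β * P.logRatio π x y' = -u := by rw [hu]; ring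
    have hnv : P.β * P.logRatio πstar x y - P.β * P.logRatio πstar x y' = -v := by rw [hv]; ring
    have e1 : P.comparisonProb ρ ⟨x, y', y, true⟩ *
        Real.exp ((P.logLik π ⟨x, y', y, true⟩ - P.logLik πstar ⟨x, y', y, true⟩) / 2)
        = (P.ν : X → ℝ) x * (P.ref.prob x y * ρ.prob x y') *
          √(Real.sigmoid u * Real.sigmoid v) := by
      simp only [comparisonProb, logLik, Comparison.chosen, Comparison.rejected, if_true, hpref,
        ← hu, ← hv]
      rw [← hexp]; ring
    have e2 : P.comparisonProb ρ ⟨x, y', y, false⟩ *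
        Real.exp ((P.logLik π ⟨x, y', y, false⟩ - P.logLik πstar ⟨x, y', y, false⟩) / 2)
        = (P.ν : X → ℝ) x * (P.ref.prob x y * ρ.prob x y') *
          √(Real.sigmoid (-u) * Real.sigmoid (-v)) := by
      simp only [comparisonProb, logLik, Comparison.chosen, Comparison.rejected, Bool.false_eq_true,
        if_false, hpref, hnu, hnv]
      rw [← hexp]; ring
    rw [hdu] at hBC
    rw [e1, e2, ← mul_add]
    refine (mul_le_mul_of_nonneg_left hBC (mul_nonneg hx.le
      (mul_nonneg (P.ref.prob_nonneg x y) (ρ.prob_nonneg x y')))).trans (le_of_eq ?_)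
    ring
  refine hmain.trans ?_
  change P.pairMean ρ (fun x y y' => 1 + -κ * P.pairError πstar π x y y' ^ 2) ≤ _
  rw [P.pairMean_add ρ (fun _ _ _ => 1), P.pairMean_const,
    P.pairMean_const_mul ρ (-κ) (fun x y y' => P.pairError πstar π x y y' ^ 2)]
  have := Real.add_one_le_exp
    (-(κ * P.pairMean ρ (fun x y y' => P.pairError πstar π x y y' ^ 2)))
  linarith

variable {Ω : Type*} {mΩ : MeasurableSpace Ω} {μ : Measure Ω} [IsProbabilityMeasure μ]
  {ℱ : Filtration ℕ mΩ} {S : ℕ → Ω → Comparison X Y} {π : ℕ → Ω → Policy X Y} {α : ℝ} {T : ℕ}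

theorem measurable_pairMean {m : MeasurableSpace Ω} {ρ : Ω → Policy X Y}
    (hρ : ∀ x y, Measurable[m] fun ω => (ρ ω).prob x y) (P : Problem X Y)
    (f : X → Y → Y → ℝ) : Measurable[m] fun ω => P.pairMean (ρ ω) f := by
  unfold pairMean promptMean
  refine Finset.measurable_sum _ fun x _ => Measurable.const_mul ?_ _
  refine Finset.measurable_sum _ fun y _ => Finset.measurable_sum _ fun y' _ => ?_
  exact ((hρ x y').const_mul _).mul_const _

/-- Time-uniform likelihood-ratio bound along a run, for one competitor. -/
theorem IsRun.measureReal_likelihood_le (h : P.IsRegularClass 𝒞 πstar R)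
    (hrun : P.IsRun μ ℱ 𝒞 α T S π) {p : Policy X Y} (hp : p ∈ 𝒞) {c : ℝ} (hc : 0 < c) :
    ∃ B : Set Ω, MeasurableSet B ∧ μ.real B ≤ 1 / c ∧ ∀ ω ∉ B, ∀ t ≤ T,
      ∑ i ∈ Finset.range t, ((P.logLik p (S (i + 1) ω) - P.logLik πstar (S (i + 1) ω)) / 2
        + P.β ^ 2 * Real.exp (-(2 * P.β * R)) / 32 *
          P.pairMean (π i ω) (fun x y y' => P.pairError πstar p x y y' ^ 2)) < Real.log c := by
  set κ := P.β ^ 2 * Real.exp (-(2 * P.β * R)) / 32 with hκ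
  have hκ0 : 0 ≤ κ := by positivity
  have key := measureReal_exists_le_exp_sum (μ := μ) (ℱ := ℱ) (T := T) (S := S)
    (q := fun t ω s => P.comparisonProb (π t ω) s)
    (f := fun s => (P.logLik p s - P.logLik πstar s) / 2)
    (h := fun t ω => κ * P.pairMean (π t ω) (fun x y y' => P.pairError πstar p x y y' ^ 2))
    (K := κ * (4 * R) ^ 2) hc
    (fun t ht s => hrun.measurable_sample (t + 1) (Finset.mem_Icc.2 ⟨by omega, by omega⟩) s)
    (fun t ht s => hrun.sampling t ht s)
    (fun t ht => (measurable_pairMean (hrun.measurable_policy t ht.le) P _).const_mul _)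
    (fun t ht ω => by
      rw [abs_mul, abs_of_nonneg hκ0]
      refine mul_le_mul_of_nonneg_left (P.abs_pairMean_le _ fun x y y' => ?_) hκ0
      rw [abs_pow]
      exact pow_le_pow_left₀ (abs_nonneg _) (h.abs_pairError_le hp x y y') 2)
    (fun t ht ω => h.sum_comparisonProb_le hp (π t ω))
  refine ⟨_, key.1, key.2, fun ω hω t ht => ?_⟩
  have h1 : ¬ c ≤ Real.exp _ := fun h' => hω ⟨t, ht, h'⟩
  rw [not_le] at h1
  exact (Real.lt_log_iff_exp_lt hc).2 h1

end Problem

end SELM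

/-! ### Regret bound -/

namespace SELM

namespace Problem

variable {X Y : Type*} [Fintype X] [Fintype Y]
  {P : Problem X Y} {πstar : Policy X Y} {R : ℝ}

theorem dpoLoss_eq_sum_logLik (P : Problem X Y) (s : ℕ → Comparison X Y) (t : ℕ)
    (p : Policy X Y) : P.dpoLoss s t p = -∑ i ∈ Finset.range t, P.logLik p (s (i + 1)) := by
  rw [dpoLoss, Finset.range_eq_Ico, Finset.sum_Ico_add' (fun i => P.logLik p (s i)) 0 t 1]
  rfl

/-- Regret bound on the event on which all likelihood-ratio bounds hold. -/
theorem IsRegularClass.regret_le {𝒞 : Set (Policy X Y)} (h : P.IsRegularClass 𝒞 πstar R)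
    {T : ℕ} (hT : 1 ≤ T) {d : ℝ} (hd : 0 < d) (hpg : P.IsPGECBound 𝒞 πstar T d)
    {Λ : ℝ} (hΛ : 1 / 2 ≤ Λ) {η α : ℝ}
    (hη : η = √(d / (T * Real.exp (2 * P.β * R) * Λ)))
    (hα : α = 2 * P.β / (η * Real.exp (2 * P.β * R)))
    {s : ℕ → Comparison X Y} {π : ℕ → Policy X Y} (hmem : ∀ t ∈ Finset.Icc 1 T, π t ∈ 𝒞)
    (hmax : ∀ t ∈ Finset.Icc 1 T, ∀ p ∈ 𝒞, P.objective α s t p ≤ P.objective α s t (π t))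
    (hlik : ∀ p ∈ 𝒞, ∀ t ≤ T,
      ∑ i ∈ Finset.range t, ((P.logLik p (s (i + 1)) - P.logLik πstar (s (i + 1))) / 2
        + P.β ^ 2 * Real.exp (-(2 * P.β * R)) / 32 *
          P.pairMean (π i) (fun x y y' => P.pairError πstar p x y y' ^ 2)) < Λ) :
    P.regret πstar π T ≤ 17 * max 1 P.β * √(d * Real.exp (2 * P.β * R) * T * Λ) := by
  have hβ := P.β_pos
  have hT0 : (0 : ℝ) < T := by exact_mod_cast hT
  have hΛ0 : 0 < Λ := by linarith
  set κ := Real.exp (2 * P.β * R) with hκ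
  have hκ1 : 1 ≤ κ := Real.one_le_exp (mul_nonneg (by linarith) h.nonneg)
  have hκ0 : 0 < κ := by linarith
  rw [Real.exp_neg, ← hκ] at hlik
  set W := √(d * κ * T * Λ) with hW
  have hW0 : 0 < W := Real.sqrt_pos.2 (by positivity)
  have hWsq : W ^ 2 = d * κ * T * Λ := Real.sq_sqrt (by positivity)
  have hη0 : 0 < η := by rw [hη]; exact Real.sqrt_pos.2 (by positivity)
  -- The identity behind the tuning of η: it balances the AM-GM step below.
  have hηW : η * W = d := by
    rw [hη, hW, ← Real.sqrt_mul (by positivity),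
      show d / (T * κ * Λ) * (d * κ * T * Λ) = d ^ 2 by field_simp]
    exact Real.sqrt_sq hd.le
  have hα0 : 0 < α := by rw [hα]; positivity
  set Q : ℕ → ℝ := fun t => ∑ τ ∈ Finset.Ico 1 t,
    P.pairMean (π τ) (fun x y y' => P.pairError πstar (π t) x y y' ^ 2) with hQ
  have hgap : ∀ t ∈ Finset.Icc 1 T, α * (P.refLog (π t) - P.refLog πstar)
      ≤ 2 * Λ - P.β ^ 2 * κ⁻¹ / 16 * Q t := by
    intro t ht
    have h1 := hmax t ht πstar h.realizable
    have h2 := hlik (π t) (hmem t ht) t (Finset.mem_Icc.1 ht).2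
    rw [objective, objective, dpoLoss_eq_sum_logLik, dpoLoss_eq_sum_logLik] at h1
    change _ - α * P.refLog πstar ≤ _ - α * P.refLog (π t) at h1
    rw [Finset.sum_add_distrib, ← Finset.sum_div, Finset.sum_sub_distrib, ← Finset.mul_sum] at h2
    -- The likelihood bound also counts i = 0, the round sampled with the reference policy; the
    -- coefficient starts at 1, so that nonnegative term is dropped.
    have h3 : Q t ≤ ∑ i ∈ Finset.range t,
        P.pairMean (π i) (fun x y y' => P.pairError πstar (π t) x y y' ^ 2) := by
      refine Finset.sum_le_sum_of_subset_of_nonneg ?_ fun _ _ _ =>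
        P.pairMean_nonneg _ fun _ _ _ => sq_nonneg _
      intro i hi
      exact Finset.mem_range.2 (Finset.mem_Ico.1 hi).2
    have h4 := mul_le_mul_of_nonneg_left h3 (show 0 ≤ P.β ^ 2 * κ⁻¹ / 32 by positivity)
    linarith
  have hE : ∑ t ∈ Finset.Icc 1 T, P.pairMean (π t) (P.pairError πstar (π t))
      ≤ √(d * ∑ t ∈ Finset.Icc 1 T, Q t) + 4 * √(d * T) := by
    classical
    -- The coefficient wants a sequence in the class at every index, but only indices 1 to T are
    -- known to lie there.
    set π' : ℕ → Policy X Y := fun t => if t ∈ Finset.Icc 1 T then π t else πstar with hπ'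
    have heq : ∀ t ∈ Finset.Icc 1 T, π' t = π t := fun t ht => if_pos ht
    have := hpg π' fun t => by
      by_cases ht : t ∈ Finset.Icc 1 T
      · rw [heq t ht]; exact hmem t ht
      · simp only [hπ', if_neg ht]; exact h.realizable
    have e1 : ∑ t ∈ Finset.Icc 1 T, P.pairMean (π' t) (P.pairError πstar (π' t))
        = ∑ t ∈ Finset.Icc 1 T, P.pairMean (π t) (P.pairError πstar (π t)) :=
      Finset.sum_congr rfl fun t ht => by rw [heq t ht]
    have e2 : ∑ t ∈ Finset.Icc 1 T, ∑ τ ∈ Finset.Ico 1 t,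
        P.pairMean (π' τ) (fun x y y' => P.pairError πstar (π' t) x y y' ^ 2)
        = ∑ t ∈ Finset.Icc 1 T, Q t :=
      Finset.sum_congr rfl fun t ht => Finset.sum_congr rfl fun τ hτ => by
        have h1 := Finset.mem_Icc.1 ht
        have h2 := Finset.mem_Ico.1 hτ
        rw [heq t ht, heq τ (Finset.mem_Icc.2 ⟨h2.1, by omega⟩)]
    rwa [e1, e2] at this
  set q := ∑ t ∈ Finset.Icc 1 T, Q t with hq
  have hq0 : 0 ≤ q := P.sum_pairMean_sq_nonneg πstar T π
  have hreg : P.regret πstar π T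
      = P.β * ∑ t ∈ Finset.Icc 1 T, P.pairMean (π t) (P.pairError πstar (π t))
        + P.β * ∑ t ∈ Finset.Icc 1 T, (P.refLog (π t) - P.refLog πstar) := by
    rw [regret, Finset.mul_sum, Finset.mul_sum, ← Finset.sum_add_distrib]
    exact Finset.sum_congr rfl fun t ht => h.value_sub_eq (hmem t ht)
  have hG : α * ∑ t ∈ Finset.Icc 1 T, (P.refLog (π t) - P.refLog πstar)
      ≤ 2 * Λ * T - P.β ^ 2 * κ⁻¹ / 16 * q := by
    rw [Finset.mul_sum]
    refine (Finset.sum_le_sum hgap).trans (le_of_eq ?_)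
    rw [Finset.sum_sub_distrib, ← Finset.mul_sum (f := Q), ← hq]
    simp
    ring
  have hαη : η * κ / 2 * α = P.β := by rw [hα]; field_simp
  have hG' : P.β * ∑ t ∈ Finset.Icc 1 T, (P.refLog (π t) - P.refLog πstar)
      ≤ W - η * P.β ^ 2 / 32 * q := by
    have h1 := mul_le_mul_of_nonneg_left hG (show 0 ≤ η * κ / 2 by positivity)
    rw [← mul_assoc, hαη] at h1
    refine h1.trans (le_of_eq ?_)
    have h2 : η * κ * (Λ * T) = W := by
      have : d * (η * κ * (Λ * T)) = d * W := by
        calc _ = η * W ^ 2 := by rw [hWsq]; ring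
          _ = (η * W) * W := by ring
          _ = _ := by rw [hηW]
      exact mul_left_cancel₀ hd.ne' this
    calc _ = η * κ * (Λ * T) - η * P.β ^ 2 / 32 * q * (κ * κ⁻¹) := by ring
      _ = _ := by rw [h2, mul_inv_cancel₀ hκ0.ne', mul_one]
  have hamgm : P.β * √(d * q) ≤ η * P.β ^ 2 / 32 * q + 8 * W := by
    have h1 : P.β * √(d * q) = √(P.β ^ 2 * (d * q)) := by
      rw [Real.sqrt_mul (sq_nonneg _), Real.sqrt_sq hβ.le]
    rw [h1, Real.sqrt_le_left (by positivity)]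
    have h2 : P.β ^ 2 * (d * q) = 4 * (η * P.β ^ 2 / 32 * q) * (8 * W) := by
      rw [← hηW]; ring
    rw [h2]
    nlinarith [sq_nonneg (η * P.β ^ 2 / 32 * q - 8 * W)]
  have hdT : √(d * T) ≤ 2 * W := by
    rw [Real.sqrt_le_left (by positivity), mul_pow, hWsq]
    have h1 : 1 / 2 ≤ κ * Λ := by nlinarith
    have h2 := mul_le_mul_of_nonneg_left h1 (show 0 ≤ d * T by positivity)
    nlinarith [mul_pos hd hT0]
  have hE' := mul_le_mul_of_nonneg_left hE hβ.le
  have hβT := mul_le_mul_of_nonneg_left hdT hβ.le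
  have m1 := mul_le_mul_of_nonneg_right (le_max_left 1 P.β) hW0.le
  have m2 := mul_le_mul_of_nonneg_right (le_max_right 1 P.β) hW0.le
  rw [hreg]
  -- The parts are 8W from AM-GM, 8βW from 4β√(dT), and W from the likelihood gap: (9 + 8β)W in all.
  nlinarith

/-- Regret of the self-exploring algorithm over a finite class. -/
theorem IsRun.le_measureReal_regret_le {𝒞 : Finset (Policy X Y)}
    (h : P.IsRegularClass (𝒞 : Set (Policy X Y)) πstar R) {T : ℕ} (hT : 1 ≤ T) {d : ℝ}
    (hd : 0 < d) (hpg : P.pgec (𝒞 : Set (Policy X Y)) πstar T ≤ d)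
    {δ : ℝ} (hδ : 0 < δ) (hδ1 : δ < 1) {η α : ℝ}
    (hη : η = √(d / (T * Real.exp (2 * P.β * R) * Real.log (𝒞.card / δ))))
    (hα : α = 2 * P.β / (η * Real.exp (2 * P.β * R)))
    {Ω : Type*} {mΩ : MeasurableSpace Ω} {μ : Measure Ω} [IsProbabilityMeasure μ]
    {ℱ : Filtration ℕ mΩ} {S : ℕ → Ω → Comparison X Y} {π : ℕ → Ω → Policy X Y}
    (hrun : P.IsRun μ ℱ (𝒞 : Set (Policy X Y)) α T S π) :
    1 - δ ≤ μ.real {ω | P.regret πstar (fun t => π t ω) T ≤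
      17 * max 1 P.β * √(d * Real.exp (2 * P.β * R) * T * Real.log (𝒞.card / δ))} := by
  have hmemstar : πstar ∈ 𝒞 := h.realizable
  have hcard : 0 < 𝒞.card := Finset.card_pos.2 ⟨_, hmemstar⟩
  -- For a singleton class log(1/δ) may be arbitrarily small, but every trained policy is then πstar
  -- and the regret vanishes.
  rcases Nat.lt_or_ge 𝒞.card 2 with hc1 | hc2
  · have hone : 𝒞.card ≤ 1 := by omega
    have huniv : {ω | P.regret πstar (fun t => π t ω) T ≤
        17 * max 1 P.β * √(d * Real.exp (2 * P.β * R) * T * Real.log (𝒞.card / δ))}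
        = Set.univ := by
      refine Set.eq_univ_of_forall fun ω => ?_
      have : P.regret πstar (fun t => π t ω) T = 0 := by
        refine Finset.sum_eq_zero fun t ht => ?_
        have hπt : π t ω ∈ 𝒞 := hrun.mem_class t ht ω
        simp only [Finset.card_le_one.1 hone _ hπt _ hmemstar, sub_self]
      change P.regret πstar (fun t => π t ω) T ≤ _
      rw [this]
      positivity
    rw [huniv]
    simp only [probReal_univ]
    linarith
  have hN : (2 : ℝ) ≤ 𝒞.card := by exact_mod_cast hc2
  have hc : 0 < 𝒞.card / δ := by positivity
  have hΛ : 1 / 2 ≤ Real.log (𝒞.card / δ) := by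
    have h2 : (2 : ℝ) ≤ 𝒞.card / δ := by
      rw [le_div_iff₀ hδ]; linarith
    have := Real.log_le_log (by norm_num) h2
    linarith [Real.log_two_gt_d9]
  -- Each competitor fails with probability at most δ/|Π|. The union covers the data-dependent π_t.
  have hB := fun p (hp : p ∈ (𝒞 : Set (Policy X Y))) => hrun.measureReal_likelihood_le h hp hc
  choose! B hBm hBle hBlik using hB
  set bad := ⋃ p ∈ 𝒞, B p with hbad
  have hbadm : MeasurableSet bad := Finset.measurableSet_biUnion _ fun p hp => hBm p hp
  have hbadle : μ.real bad ≤ δ := by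
    calc μ.real bad ≤ ∑ p ∈ 𝒞, μ.real (B p) := measureReal_biUnion_finset_le _ _
      _ ≤ ∑ _p ∈ 𝒞, 1 / (𝒞.card / δ) := Finset.sum_le_sum fun p hp => hBle p hp
      _ = δ := by
        rw [Finset.sum_const, nsmul_eq_mul]
        field_simp
  have hcompl : μ.real badᶜ = 1 - μ.real bad := probReal_compl_eq_one_sub hbadm
  calc 1 - δ ≤ μ.real badᶜ := by rw [hcompl]; linarith
    _ ≤ _ := by
      refine measureReal_mono fun ω hω => ?_
      refine h.regret_le hT hd (h.isPGECBound_of_pgec_le hpg) hΛ hη hα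
        (s := fun i => S i ω) (fun t ht => hrun.mem_class t ht ω)
        (fun t ht p hp => hrun.argmax t ht ω p hp) fun p hp t ht => ?_
      refine hBlik p hp ω (fun hω' => hω ?_) t ht
      exact Set.mem_biUnion (Finset.mem_coe.2 hp) hω'

end Problem

end SELM

theorem theorem2 :
    -- regret bound, with an absolute constant
    (∃ C : ℝ, 0 < C ∧
      ∀ (X Y : Type*) [Fintype X] [Fintype Y] (P : SELM.Problem X Y)
        (𝒞 : Finset (SELM.Policy X Y)) (πstar : SELM.Policy X Y) (R : ℝ),
        P.IsRegularClass (𝒞 : Set (SELM.Policy X Y)) πstar R →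
      ∀ (T : ℕ), 1 ≤ T →
      ∀ (d : ℝ), 0 < d → P.pgec (𝒞 : Set (SELM.Policy X Y)) πstar T ≤ d →
      ∀ (δ : ℝ), 0 < δ → δ < 1 →
      ∀ (η α : ℝ),
        η = √(d / (T * Real.exp (2 * P.β * R) * Real.log (𝒞.card / δ))) →
        α = 2 * P.β / (η * Real.exp (2 * P.β * R)) →
      ∀ (Ω : Type*) [mΩ : MeasurableSpace Ω] (μ : MeasureTheory.Measure Ω)
        [MeasureTheory.IsProbabilityMeasure μ] (ℱ : MeasureTheory.Filtration ℕ mΩ)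
        (S : ℕ → Ω → SELM.Comparison X Y) (π : ℕ → Ω → SELM.Policy X Y),
        P.IsRun μ ℱ (𝒞 : Set (SELM.Policy X Y)) α T S π →
      1 - δ ≤ μ.real {ω | P.regret πstar (fun t => π t ω) T ≤
        C * max 1 P.β *
          √(d * Real.exp (2 * P.β * R) * T * Real.log (𝒞.card / δ))}) ∧
    -- log-linear classes with `k`-dimensional features
    (∃ C : ℝ, 0 < C ∧
      ∀ (X Y : Type*) [Fintype X] [Fintype Y] (P : SELM.Problem X Y)
        (k : ℕ) (φ : X → Y → EuclideanSpace ℝ (Fin k)) (Θ : Set (EuclideanSpace ℝ (Fin k)))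
        (πstar : SELM.Policy X Y) (R : ℝ),
        P.IsRegularClass (SELM.logLinearClass φ P.β Θ) πstar R →
      ∀ (T : ℕ), 1 ≤ T →
      ∀ (ι : ℝ), ι = Real.log (2 + k * T * R ^ 2) →
        P.IsPGECBound (SELM.logLinearClass φ P.β Θ) πstar T
          (P.pgec (SELM.logLinearClass φ P.β Θ) πstar T) ∧
        P.pgec (SELM.logLinearClass φ P.β Θ) πstar T ≤
          C * (k * ι) * (1 + R ^ 2 * min 1 (k * ι / T))) := by
  refine ⟨⟨17, by norm_num, ?_⟩, ⟨128, by norm_num, ?_⟩⟩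
  · intro X Y _ _ P 𝒞 πstar R h T hT d hd hpg δ hδ hδ1 η α hη hα Ω mΩ μ _ ℱ S π hrun
    exact hrun.le_measureReal_regret_le h hT hd hpg hδ hδ1 hη hα
  · intro X Y _ _ P k φ Θ πstar R h T hT ι hι
    refine ⟨h.isPGECBound_of_pgec_le le_rfl, ?_⟩
    refine csInf_le ⟨0, fun d hd => hd.1⟩ ⟨?_, h.isPGECBound_logLinear hT hι⟩
    have hι0 : 0 ≤ ι := by
      rw [hι]
      refine Real.log_nonneg ?_
      have : (0 : ℝ) ≤ k * T * R ^ 2 := by positivity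
      linarith
    have : 0 ≤ min 1 (k * ι / T) := le_min zero_le_one (by positivity)
    positivity
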